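/- Let $(M,g)$ be a compact connected smooth Riemannian manifold (without boundary) of dimension $n$, with Levi-Civita connection $\nabla$, whose Ricci tensor satisfies $\mathrm{Ric}(X,X)\ge (n-1)\,g(X,X)$ for all tangent vectors $X$. Let $\triangle f=-\mathrm{tr}^g\,\nabla^2 f$ be the non-negative Laplacian. If the lowest possible eigenvalue $n$ is achieved, i.e. there is a smooth function $f:M\to\mathbb R$, not identically zero, with $\triangle f=nf$, then $(M,g)$ is an Einstein space: there is a constant $c\in\mathbb R$ with $\mathrm{Ric}=c\,g$ on $M$. -/

import Mathlib

open Bundle VectorField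
open scoped Manifold ContDiff

noncomputable section

namespace RiemannianGeometry

section

variable {E : Type*} [NormedAddCommGroup E] [NormedSpace ℝ E] [FiniteDimensional ℝ E]
  {H : Type*} [TopologicalSpace H] {I : ModelWithCorners ℝ E H}
  {M : Type*} [TopologicalSpace M] [ChartedSpace H M] [IsManifold I ∞ M]
  [RiemannianBundle (fun x : M ↦ TangentSpace I x)]
  [IsContMDiffRiemannianBundle I ∞ E (fun x : M ↦ TangentSpace I x)]

instance finiteDimensional_tangentSpace (x : M) : FiniteDimensional ℝ (TangentSpace I x) :=
  inferInstanceAs (FiniteDimensional ℝ E)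

instance completeSpace_tangentSpace (x : M) : CompleteSpace (TangentSpace I x) :=
  FiniteDimensional.complete ℝ _

theorem mdiffAt_inner {X Y : Π x : M, TangentSpace I x} {x : M}
    (hX : MDiffAt (T% X) x) (hY : MDiffAt (T% Y) x) :
    MDiffAt (fun y : M ↦ inner ℝ (X y) (Y y)) x :=
  MDifferentiableAt.inner_bundle (IB := I) (F := E) (E := fun x : M ↦ TangentSpace I x) hX hY

/-- Half of the right-hand side of the Koszul formula
`2 g(∇_X Y, Z) = X g(Y,Z) + Y g(X,Z) - Z g(X,Y) + g([X,Y],Z) - g([X,Z],Y) - g([Y,Z],X)`. -/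
def koszul (Y X Z : Π x : M, TangentSpace I x) (x : M) : ℝ :=
  (1 / 2 : ℝ) *
    (d% (fun y : M ↦ inner ℝ (Y y) (Z y)) x (X x)
      + d% (fun y : M ↦ inner ℝ (X y) (Z y)) x (Y x)
      - d% (fun y : M ↦ inner ℝ (X y) (Y y)) x (Z x)
      + inner ℝ (mlieBracket I X Y x) (Z x)
      - inner ℝ (mlieBracket I X Z x) (Y x)
      - inner ℝ (mlieBracket I Y Z x) (X x))

theorem koszul_tensorial₁ {Y : Π x : M, TangentSpace I x} {x : M} (hY : MDiffAt (T% Y) x)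
    (Z : Π x : M, TangentSpace I x) (hZ : MDiffAt (T% Z) x) :
    TensorialAt I E (fun X ↦ koszul (I := I) Y X Z x) x where
  smul {f X} hf hX := by
    have h1 := mvfderiv_fun_mul hf (mdiffAt_inner hX hZ)
    have h2 := mvfderiv_fun_mul hf (mdiffAt_inner hX hY)
    simp [koszul, inner_smul_left, h1, h2, mlieBracket_smul_left hf hX, inner_add_left,
      inner_smul_right]
    ring
  add {X X'} hX hX' := by
    have h1 := mvfderiv_fun_add (mdiffAt_inner hX hZ) (mdiffAt_inner hX' hZ)
    have h2 := mvfderiv_fun_add (mdiffAt_inner hX hY) (mdiffAt_inner hX' hY)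
    simp [koszul, h1, h2, mlieBracket_add_left hX hX', inner_add_left, inner_add_right]
    ring

theorem koszul_tensorial₂ {Y : Π x : M, TangentSpace I x} {x : M} (hY : MDiffAt (T% Y) x)
    (X : Π x : M, TangentSpace I x) (hX : MDiffAt (T% X) x) :
    TensorialAt I E (fun Z ↦ koszul (I := I) Y X Z x) x where
  smul {f Z} hf hZ := by
    have h1 := mvfderiv_fun_mul hf (mdiffAt_inner hY hZ)
    have h2 := mvfderiv_fun_mul hf (mdiffAt_inner hX hZ)
    simp [koszul, inner_smul_left, h1, h2, mlieBracket_smul_right hf hZ, inner_add_left,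
      inner_smul_right]
    rw [real_inner_comm (X x) (Z x), real_inner_comm (Y x) (Z x)]
    ring
  add {Z Z'} hZ hZ' := by
    have h1 := mvfderiv_fun_add (mdiffAt_inner hY hZ) (mdiffAt_inner hY hZ')
    have h2 := mvfderiv_fun_add (mdiffAt_inner hX hZ) (mdiffAt_inner hX hZ')
    simp [koszul, h1, h2, mlieBracket_add_right hZ hZ', inner_add_left, inner_add_right]
    ring

theorem koszul_add {Y Y' X Z : Π x : M, TangentSpace I x} {x : M}
    (hY : MDiffAt (T% Y) x) (hY' : MDiffAt (T% Y') x)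
    (hX : MDiffAt (T% X) x) (hZ : MDiffAt (T% Z) x) :
    koszul (I := I) (Y + Y') X Z x = koszul (I := I) Y X Z x + koszul (I := I) Y' X Z x := by
  have h1 := mvfderiv_fun_add (mdiffAt_inner hY hZ) (mdiffAt_inner hY' hZ)
  have h2 := mvfderiv_fun_add (mdiffAt_inner hX hY) (mdiffAt_inner hX hY')
  simp [koszul, h1, h2, mlieBracket_add_right hY hY', mlieBracket_add_left hY hY',
    inner_add_left, inner_add_right]
  ring

theorem koszul_smul {Y X Z : Π x : M, TangentSpace I x} {f : M → ℝ} {x : M}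
    (hf : MDiffAt f x) (hY : MDiffAt (T% Y) x)
    (hX : MDiffAt (T% X) x) (hZ : MDiffAt (T% Z) x) :
    koszul (I := I) (f • Y) X Z x =
      f x * koszul (I := I) Y X Z x + d% f x (X x) * inner ℝ (Y x) (Z x) := by
  have h1 := mvfderiv_fun_mul hf (mdiffAt_inner hY hZ)
  have h2 := mvfderiv_fun_mul hf (mdiffAt_inner hX hY)
  simp [koszul, h1, h2, mlieBracket_smul_right hf hY, mlieBracket_smul_left hf hY,
    inner_add_left, inner_smul_left, inner_smul_right]
  rw [real_inner_comm (X x) (Y x)]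
  ring

/-- The endomorphism of the tangent space that represents a bilinear form through the metric:
`g(sharp B u, w) = B u w`. -/
def sharp {x : M} (B : TangentSpace I x →L[ℝ] TangentSpace I x →L[ℝ] ℝ) :
    TangentSpace I x →L[ℝ] TangentSpace I x :=
  LinearMap.toContinuousLinearMap
    { toFun := fun u ↦ (InnerProductSpace.toDual ℝ (TangentSpace I x)).symm (B u)
      map_add' := fun u v ↦ by simp
      map_smul' := fun c u ↦ by simp }

open Classical in
/-- `∇Y` at `x`, as the endomorphism `u ↦ ∇_u Y` of the tangent space which satisfies the Koszul
formula (and `0` if `Y` is not differentiable at `x`). -/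
def leviCivitaFun (Y : Π x : M, TangentSpace I x) (x : M) :
    TangentSpace I x →L[ℝ] TangentSpace I x :=
  if hY : MDiffAt (T% Y) x then
    sharp (TensorialAt.mkHom₂ (I := I) (F := E) (F' := E)
      (fun X Z ↦ koszul (I := I) Y X Z x) x (koszul_tensorial₁ hY) (koszul_tensorial₂ hY))
  else 0

theorem inner_leviCivitaFun {Y X Z : Π x : M, TangentSpace I x} {x : M}
    (hY : MDiffAt (T% Y) x) (hX : MDiffAt (T% X) x) (hZ : MDiffAt (T% Z) x) :
    inner ℝ (leviCivitaFun Y x (X x)) (Z x) = koszul (I := I) Y X Z x := by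
  rw [leviCivitaFun, dif_pos hY]
  simp only [sharp, LinearMap.coe_toContinuousLinearMap', LinearMap.coe_mk, AddHom.coe_mk,
    InnerProductSpace.toDual_symm_apply]
  exact TensorialAt.mkHom₂_apply _ _ hX hZ

theorem clm_ext_fields {x : M} {A B : TangentSpace I x →L[ℝ] TangentSpace I x}
    (h : ∀ X Z : Π x : M, TangentSpace I x, MDiffAt (T% X) x → MDiffAt (T% Z) x →
      inner ℝ (A (X x)) (Z x) = inner ℝ (B (X x)) (Z x)) : A = B := by
  ext1 u
  refine ext_inner_right ℝ fun w ↦ ?_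
  have := h (FiberBundle.extend E u) (FiberBundle.extend E w)
    (FiberBundle.mdifferentiableAt_extend I E u) (FiberBundle.mdifferentiableAt_extend I E w)
  simpa using this

variable (I M) in
/-- The Levi-Civita connection: `leviCivita I M Y x u` is `∇_u Y` at `x`. -/
def leviCivita : CovariantDerivative I E (fun x : M ↦ TangentSpace I x) where
  toFun := leviCivitaFun
  isCovariantDerivativeOnUniv :=
    { add := fun {Y Y' x} hY hY' _ ↦ by
        refine clm_ext_fields fun X Z hX hZ ↦ ?_
        rw [inner_leviCivitaFun (mdifferentiableAt_add_section hY hY') hX hZ,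
          koszul_add hY hY' hX hZ]
        simp [inner_add_left, inner_leviCivitaFun, hY, hY', hX, hZ]
      leibniz := fun {Y f x} hY hf _ ↦ by
        refine clm_ext_fields fun X Z hX hZ ↦ ?_
        rw [inner_leviCivitaFun (hf.smul_section hY) hX hZ, koszul_smul hf hY hX hZ]
        simp [inner_add_left, inner_smul_left, inner_leviCivitaFun, hY, hX, hZ] }

theorem leviCivita_torsion : (leviCivita I M).torsion = 0 := by
  rw [CovariantDerivative.torsion_eq_zero_iff]
  intro X Y x hX hY
  refine ext_inner_right ℝ fun w ↦ ?_
  have hZ := FiberBundle.mdifferentiableAt_extend I E w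
  have h1 := inner_leviCivitaFun hY hX hZ
  have h2 := inner_leviCivitaFun hX hY hZ
  rw [FiberBundle.extend_apply_self] at h1 h2
  rw [inner_sub_left]
  change inner ℝ (leviCivitaFun Y x (X x)) w - inner ℝ (leviCivitaFun X x (Y x)) w = _
  rw [h1, h2]
  simp only [koszul, FiberBundle.extend_apply_self]
  rw [mlieBracket_swap_apply (V := Y) (W := X), inner_neg_left]
  simp only [real_inner_comm]
  ring

theorem leviCivita_metric {X Y Z : Π x : M, TangentSpace I x} {x : M}
    (hX : MDiffAt (T% X) x) (hY : MDiffAt (T% Y) x) (hZ : MDiffAt (T% Z) x) :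
    d% (fun y : M ↦ inner ℝ (Y y) (Z y)) x (X x) =
      inner ℝ (leviCivita I M Y x (X x)) (Z x) + inner ℝ (Y x) (leviCivita I M Z x (X x)) := by
  have h1 := inner_leviCivitaFun hY hX hZ
  have h2 := inner_leviCivitaFun hZ hX hY
  change _ = inner ℝ (leviCivitaFun Y x (X x)) (Z x) + inner ℝ (Y x) (leviCivitaFun Z x (X x))
  rw [← real_inner_comm (Y x), h1, h2]
  simp only [koszul]
  rw [mlieBracket_swap_apply (V := Z) (W := Y), inner_neg_left]
  simp only [real_inner_comm]
  ring

variable (I) in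
/-- The gradient of `f`: `g(∇f, v) = df(v)`. -/
def gradient (f : M → ℝ) (x : M) : TangentSpace I x :=
  (InnerProductSpace.toDual ℝ (TangentSpace I x)).symm (d% f x)

variable (I) in
/-- The Hessian `∇²f(u, v) = g(∇_u ∇f, v)`. -/
def hessian (f : M → ℝ) (x : M) (u v : TangentSpace I x) : ℝ :=
  inner ℝ (leviCivita I M (gradient I f) x u) v

/-- The metric trace `∑ B(eᵢ, eᵢ)` of a bilinear form, over an orthonormal basis of `T_x M`. -/
def metricTrace {x : M} (B : TangentSpace I x → TangentSpace I x → ℝ) : ℝ :=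
  ∑ i, B (stdOrthonormalBasis ℝ (TangentSpace I x) i) (stdOrthonormalBasis ℝ (TangentSpace I x) i)

variable (I) in
/-- The non-negative Laplacian `Δf = -tr ∇²f`. -/
def laplacian (f : M → ℝ) (x : M) : ℝ :=
  -metricTrace (hessian I f x)

/-- The curvature `R(X, Y)Z = ∇_X ∇_Y Z - ∇_Y ∇_X Z - ∇_[X, Y] Z` on vector fields. -/
def curvature (X Y Z : Π x : M, TangentSpace I x) (x : M) : TangentSpace I x :=
  leviCivita I M (fun y ↦ leviCivita I M Z y (Y y)) x (X x)
    - leviCivita I M (fun y ↦ leviCivita I M Z y (X y)) x (Y x)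
    - leviCivita I M Z x (mlieBracket I X Y x)

/-- The curvature tensor at `x`, computed on the extensions of tangent vectors at `x` to vector
fields that are smooth near `x` (its value does not depend on the extensions). -/
def curvatureAt (x : M) (u v w : TangentSpace I x) : TangentSpace I x :=
  curvature (I := I) (FiberBundle.extend E u) (FiberBundle.extend E v) (FiberBundle.extend E w) x

/-- The Ricci tensor `Ric(v, w) = tr (u ↦ R(u, v)w)`. -/
def ricci (x : M) (v w : TangentSpace I x) : ℝ :=
  metricTrace fun u u' : TangentSpace I x ↦ inner ℝ (curvatureAt x u v w) u'

variable (I M) in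
/-- `(M, g)` is an Einstein space: `Ric = c g` with a constant `c`. -/
def IsEinstein : Prop :=
  ∃ c : ℝ, ∀ (x : M) (v w : TangentSpace I x), ricci x v w = c * inner ℝ v w

end

end RiemannianGeometry

end

/-!
By the Bochner formula, `|∇f|² + f²` is subharmonic when `Δf = nf` and `Ric ≥ (n - 1) g`, hence
constant by the strong maximum principle, and the vanishing of its Laplacian forces Obata's equation
`∇²f = -f g`. This equation determines all curvatures `R(X, Y)∇f`. Differentiating them and using
the second Bianchi identity gives `∇f(s) = 2f s` for the excess `s = scal - n (n - 1)`, so that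
`s |∇f|²` is constant along `∇f`. At a maximum of `s |∇f|² e^f` the derivative `s |∇f|⁴ e^f` of this
function along `∇f` vanishes, so this maximum is `0`. Since `s ≥ 0` and the zeros of `∇f` have empty
interior, `s = 0`: the nonnegative form `Ric - (n - 1) g` has trace `0`, so it vanishes.
-/

noncomputable section

open Set Filter Topology Module

namespace RiemannianGeometry

section LinearAlgebra

variable {V W ι κ : Type*} [NormedAddCommGroup V] [InnerProductSpace ℝ V] [AddCommGroup W]
  [Module ℝ W] [Fintype ι] [Fintype κ]

theorem map_eq_sum_inner_smul (b : OrthonormalBasis ι ℝ V) (L : V →ₗ[ℝ] W) (v : V) :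
    L v = ∑ i, inner ℝ (b i) v • L (b i) := by
  conv_lhs => rw [← b.sum_repr' v]
  simp only [map_sum, map_smul]

theorem exists_orthonormalBasis_eq [FiniteDimensional ℝ V] {e : ι → V} (he : Orthonormal ℝ e)
    (hcard : Fintype.card ι = finrank ℝ V) : ∃ b : OrthonormalBasis ι ℝ V, ∀ i, b i = e i := by
  refine ⟨.mk he (he.linearIndependent.span_eq_top_of_card_eq_finrank' hcard).ge, fun i ↦ ?_⟩
  rw [OrthonormalBasis.coe_mk]

theorem sum_bilin_orthonormalBasis_eq (B : V →ₗ[ℝ] V →ₗ[ℝ] ℝ) (b : OrthonormalBasis ι ℝ V)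
    (b' : OrthonormalBasis κ ℝ V) : ∑ k, B (b' k) (b' k) = ∑ i, B (b i) (b i) :=
  calc ∑ k, B (b' k) (b' k)
    _ = ∑ k, ∑ i, inner ℝ (b i) (b' k) * B (b i) (b' k) :=
        Finset.sum_congr rfl fun k _ ↦ map_eq_sum_inner_smul b (B.flip (b' k)) (b' k)
    _ = ∑ i, ∑ k, inner ℝ (b' k) (b i) * B (b i) (b' k) := by
        rw [Finset.sum_comm]; simp only [real_inner_comm]
    _ = ∑ i, B (b i) (b i) :=
        Finset.sum_congr rfl fun i _ ↦ (map_eq_sum_inner_smul b' (B (b i)) (b i)).symm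

-- Infinitesimal rotations of an orthonormal basis leave the trace of `B` unchanged.
theorem sum_bilin_add_bilin_eq_zero_of_skew (B : V →ₗ[ℝ] V →ₗ[ℝ] ℝ) (b : OrthonormalBasis ι ℝ V)
    {w : ι → V} (hw : ∀ i j, inner ℝ (w i) (b j) + inner ℝ (b i) (w j) = 0) :
    ∑ i, (B (w i) (b i) + B (b i) (w i)) = 0 := by
  have hleft : ∑ i, B (w i) (b i) = ∑ i, ∑ j, inner ℝ (b i) (w j) * B (b i) (b j) := by
    rw [Finset.sum_comm]
    exact Finset.sum_congr rfl fun i _ ↦ map_eq_sum_inner_smul b (B.flip (b i)) (w i)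
  have hright : ∑ i, B (b i) (w i) = ∑ i, ∑ j, inner ℝ (w i) (b j) * B (b i) (b j) := by
    refine Finset.sum_congr rfl fun i _ ↦ (map_eq_sum_inner_smul b (B (b i)) (w i)).trans ?_
    simp only [real_inner_comm, smul_eq_mul]
  rw [Finset.sum_add_distrib, hleft, hright]
  simp only [← Finset.sum_add_distrib, ← add_mul]
  simp only [add_comm (inner ℝ (b _) (w _)), hw, zero_mul, Finset.sum_const_zero]

theorem eq_zero_of_sum_inner_self_nonpos {V' : Type*} [NormedAddCommGroup V']
    [InnerProductSpace ℝ V'] (b : OrthonormalBasis ι ℝ V) {L : V →ₗ[ℝ] V'}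
    (h : ∑ i, inner ℝ (L (b i)) (L (b i)) ≤ (0 : ℝ)) : L = 0 := by
  have hnonneg (i : ι) : 0 ≤ inner ℝ (L (b i)) (L (b i)) := real_inner_self_nonneg
  have hsum := h.antisymm (Finset.sum_nonneg fun i _ ↦ hnonneg i)
  exact b.toBasis.ext fun i ↦ by
    simpa using (Finset.sum_eq_zero_iff_of_nonneg fun j _ ↦ hnonneg j).1 hsum i (Finset.mem_univ i)

theorem bilin_eq_zero_of_trace_eq_zero (B : V →ₗ[ℝ] V →ₗ[ℝ] ℝ) (b : OrthonormalBasis ι ℝ V)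
    (hsymm : ∀ v w, B v w = B w v) (hnonneg : ∀ v, 0 ≤ B v v) (htr : ∑ i, B (b i) (b i) = 0)
    (v w : V) : B v w = 0 := by
  have hdiag (i : ι) : B (b i) (b i) = 0 :=
    (Finset.sum_eq_zero_iff_of_nonneg fun j _ ↦ hnonneg (b j)).1 htr i (Finset.mem_univ i)
  have hrow (i : ι) : B (b i) w = 0 := by
    have hCS := LinearMap.BilinForm.apply_mul_apply_le_of_forall_zero_le B hnonneg (b i) w
    rw [hsymm w, hdiag, zero_mul] at hCS
    exact mul_self_eq_zero.1 (hCS.antisymm (mul_self_nonneg _))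
  simpa [hrow] using map_eq_sum_inner_smul b (B.flip w) v

theorem pair_symm_of_bianchi {α : Type*} {R : α → α → α → α → ℝ}
    (hleft : ∀ a b c d, R a b c d = -R b a c d) (hright : ∀ a b c d, R a b c d = -R a b d c)
    (hBianchi : ∀ a b c d, R a b c d + R b c a d + R c a b d = 0) (a b c d : α) :
    R a b c d = R c d a b := by
  -- Add the four Bianchi identities obtained by fixing each of the four arguments.
  linarith [hBianchi a b c d, hBianchi b c d a, hBianchi c d a b, hBianchi d a b c,
    hright a b c d, hright b c a d, hright c a b d, hright c d b a, hright d b c a,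
    hright d a c b, hleft a b d c, hleft b c d a, hleft c a d b, hleft a d b c, hleft d b c a,
    hleft d a c b, hleft d b a c, hleft c d a b, hleft c d b a]

end LinearAlgebra

section Calculus

variable {E : Type*} [NormedAddCommGroup E] [NormedSpace ℝ E]
  {H : Type*} [TopologicalSpace H] {I : ModelWithCorners ℝ E H}
  {M : Type*} [TopologicalSpace M] [ChartedSpace H M]
  {E' : Type*} [NormedAddCommGroup E'] [NormedSpace ℝ E']
  {H' : Type*} [TopologicalSpace H'] {I' : ModelWithCorners ℝ E' H'}
  {N : Type*} [TopologicalSpace N] [ChartedSpace H' N]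

theorem mdiffAt_of_contMDiff {f : M → N} (hf : CMDiff ∞ f) (x : M) : MDiffAt f x :=
  hf.mdifferentiable (by simp) x

/-- The derivative `X f` of a function along a vector field. -/
def dirDeriv (X : Π x : M, TangentSpace I x) (f : M → ℝ) (x : M) : ℝ := d% f x (X x)

variable {f g : M → ℝ} {X Y Z : Π x : M, TangentSpace I x} {x : M}

theorem dirDeriv_const (X : Π x : M, TangentSpace I x) (c : ℝ) (x : M) :
    dirDeriv X (fun _ ↦ c) x = 0 := by
  simp [dirDeriv, mvfderiv_const]

theorem dirDeriv_add (X : Π x : M, TangentSpace I x) (hf : MDiffAt f x) (hg : MDiffAt g x) :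
    dirDeriv X (fun y ↦ f y + g y) x = dirDeriv X f x + dirDeriv X g x := by
  simp [dirDeriv, mvfderiv_fun_add hf hg]

theorem dirDeriv_sub (X : Π x : M, TangentSpace I x) (hf : MDiffAt f x) (hg : MDiffAt g x) :
    dirDeriv X (fun y ↦ f y - g y) x = dirDeriv X f x - dirDeriv X g x := by
  simp [dirDeriv, mvfderiv_fun_sub hf hg]

theorem dirDeriv_mul (X : Π x : M, TangentSpace I x) (hf : MDiffAt f x) (hg : MDiffAt g x) :
    dirDeriv X (fun y ↦ f y * g y) x = f x * dirDeriv X g x + g x * dirDeriv X f x := by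
  simp [dirDeriv, mvfderiv_fun_mul hf hg]

theorem dirDeriv_sum (X : Π x : M, TangentSpace I x) {ι : Type*} {s : Finset ι} {F : ι → M → ℝ}
    (hF : ∀ i, CMDiff ∞ (F i)) (x : M) :
    dirDeriv X (fun y ↦ ∑ i ∈ s, F i y) x = ∑ i ∈ s, dirDeriv X (F i) x := by
  induction s using Finset.cons_induction with
  | empty => simpa using dirDeriv_const X 0 x
  | cons i s hi ih =>
    simp only [Finset.sum_cons]
    rw [dirDeriv_add X (mdiffAt_of_contMDiff (hF i) x)
      (mdiffAt_of_contMDiff (contMDiff_finsetSum fun j _ ↦ hF j) x), ih]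

theorem dirDeriv_comp (X : Π x : M, TangentSpace I x) {φ : ℝ → ℝ} {φ' : ℝ}
    (hφ : HasDerivAt φ φ' (f x)) (hf : MDiffAt f x) :
    dirDeriv X (fun y ↦ φ (f y)) x = φ' * dirDeriv X f x := by
  have h := (hφ.hasFDerivAt.hasMFDerivAt.comp x hf.hasMFDerivAt).mfderiv
  rw [mul_comm]
  exact DFunLike.congr_fun h (X x)

theorem dirDeriv_congr (h : f =ᶠ[𝓝 x] g) : dirDeriv X f x = dirDeriv X g x := by
  rw [dirDeriv, dirDeriv, mvfderiv, mvfderiv, h.mfderiv_eq]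
  rfl

variable [IsManifold I ∞ M]

theorem contMDiff_dirDeriv (hX : CMDiff ∞ (T% X)) (hf : CMDiff ∞ f) : CMDiff ∞ (dirDeriv X f) :=
  (contMDiff_snd_tangentBundle_modelSpace ℝ 𝓘(ℝ, ℝ)).comp
    ((hf.contMDiff_tangentMap le_rfl).comp hX)

end Calculus

section VectorFields

variable {E : Type*} [NormedAddCommGroup E] [NormedSpace ℝ E] [FiniteDimensional ℝ E]
  {H : Type*} [TopologicalSpace H] {I : ModelWithCorners ℝ E H}
  {M : Type*} [TopologicalSpace M] [ChartedSpace H M] [IsManifold I ∞ M]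
  {f : M → ℝ} {X Y Z : Π x : M, TangentSpace I x}

omit [FiniteDimensional ℝ E] in
theorem isManifold_infty_add_one : IsManifold I (((⊤ : ℕ∞) : WithTop ℕ∞) + 1) M :=
  inferInstanceAs (IsManifold I ∞ M)

omit [FiniteDimensional ℝ E] in
theorem isManifold_minSmoothness_two : IsManifold I (minSmoothness ℝ 2) M := by
  rw [minSmoothness_of_isRCLikeNormedField]
  infer_instance

omit [FiniteDimensional ℝ E] in
theorem isManifold_minSmoothness_three : IsManifold I (minSmoothness ℝ 3) M := by
  rw [minSmoothness_of_isRCLikeNormedField]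
  infer_instance

attribute [local instance] isManifold_infty_add_one isManifold_minSmoothness_two
  isManifold_minSmoothness_three

theorem contMDiff_mlieBracket (hX : CMDiff ∞ (T% X)) (hY : CMDiff ∞ (T% Y)) :
    CMDiff ∞ (T% (mlieBracket I X Y)) :=
  ContDiff.mlieBracket_vectorField (n := ⊤) (m := ⊤) hX hY (by simp)

theorem mlieBracket_jacobi (hX : CMDiff ∞ (T% X)) (hY : CMDiff ∞ (T% Y)) (hZ : CMDiff ∞ (T% Z))
    (x : M) :
    mlieBracket I X (mlieBracket I Y Z) x =
      mlieBracket I (mlieBracket I X Y) Z x + mlieBracket I Y (mlieBracket I X Z) x := by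
  have h2 : minSmoothness ℝ 2 ≤ ∞ := by
    rw [minSmoothness_of_isRCLikeNormedField]
    exact ENat.LEInfty.out
  exact leibniz_identity_mlieBracket_apply ((hX x).of_le h2) ((hY x).of_le h2) ((hZ x).of_le h2)

theorem mlieBracket_jacobi_cyclic (hX : CMDiff ∞ (T% X)) (hY : CMDiff ∞ (T% Y))
    (hZ : CMDiff ∞ (T% Z)) (x : M) :
    mlieBracket I X (mlieBracket I Y Z) x + mlieBracket I Y (mlieBracket I Z X) x +
      mlieBracket I Z (mlieBracket I X Y) x = 0 := by
  have hneg : mlieBracket I Y (mlieBracket I Z X) x = -mlieBracket I Y (mlieBracket I X Z) x := by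
    have hXZ := mdiffAt_of_contMDiff (contMDiff_mlieBracket hX hZ) x
    simpa [mlieBracket_swap (V := Z) (W := X)] using
      mlieBracket_const_smul_right (V := Y) (c := (-1 : ℝ)) hXZ
  rw [mlieBracket_jacobi hX hY hZ, hneg, mlieBracket_swap_apply (V := Z)]
  abel

variable [T2Space M]

theorem exists_contMDiff_eventuallyEq {x : M} {u : Set M} (hu : IsOpen u) (hx : x ∈ u)
    (hX : CMDiff[u] ∞ (T% X)) :
    ∃ Y : Π x : M, TangentSpace I x, CMDiff ∞ (T% Y) ∧ ∀ᶠ y in 𝓝 x, Y y = X y := by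
  obtain ⟨ψ, -, hψ⟩ := (SmoothBumpFunction.nhds_basis_tsupport (I := I) x).mem_iff.1
    (hu.mem_nhds hx)
  refine ⟨(ψ : M → ℝ) • X,
    ContMDiffOn.smul_section_of_tsupport ψ.contMDiff.contMDiffOn hu hψ hX, ?_⟩
  filter_upwards [ψ.eventuallyEq_one] with y hy
  simp [hy]

theorem exists_contMDiff_eventuallyEq_extend {x : M} (v : TangentSpace I x) :
    ∃ Y : Π x : M, TangentSpace I x, CMDiff ∞ (T% Y) ∧
      ∀ᶠ y in 𝓝 x, Y y = FiberBundle.extend E v y := by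
  obtain ⟨s, hs, h⟩ := FiberBundle.exists_contMDiffOn_extend (k := ∞) I E v
  obtain ⟨u, hus, hu, hxu⟩ := mem_nhds_iff.1 hs
  exact exists_contMDiff_eventuallyEq hu hxu (h.mono hus)

theorem exists_contMDiff_eq {x : M} (v : TangentSpace I x) :
    ∃ Y : Π x : M, TangentSpace I x, CMDiff ∞ (T% Y) ∧ Y x = v := by
  obtain ⟨Y, hY, hYv⟩ := exists_contMDiff_eventuallyEq_extend v
  exact ⟨Y, hY, by simpa using hYv.self_of_nhds⟩

omit [T2Space M] in
theorem mlieBracket_smul_section_right (hf : CMDiff ∞ f) (hZ : CMDiff ∞ (T% Z))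
    (X : Π x : M, TangentSpace I x) :
    mlieBracket I X (f • Z) = dirDeriv X f • Z + f • mlieBracket I X Z := by
  ext y
  exact mlieBracket_smul_right (mdiffAt_of_contMDiff hf y) (mdiffAt_of_contMDiff hZ y)

omit [T2Space M] in
theorem mlieBracket_mlieBracket_smul_section (X : Π x : M, TangentSpace I x)
    (hY : CMDiff ∞ (T% Y)) (hZ : CMDiff ∞ (T% Z)) (hf : CMDiff ∞ f) (x : M) :
    mlieBracket I X (mlieBracket I Y (f • Z)) x =
      dirDeriv X (dirDeriv Y f) x • Z x + dirDeriv Y f x • mlieBracket I X Z x +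
        (dirDeriv X f x • mlieBracket I Y Z x + f x • mlieBracket I X (mlieBracket I Y Z) x) := by
  have hYf := contMDiff_dirDeriv hY hf
  have hYZ := contMDiff_mlieBracket hY hZ
  rw [mlieBracket_smul_section_right hf hZ,
    mlieBracket_add_right (mdiffAt_of_contMDiff (hYf.smul_section hZ) x)
      (mdiffAt_of_contMDiff (hf.smul_section hYZ) x),
    mlieBracket_smul_section_right hYf hZ, mlieBracket_smul_section_right hf hYZ]
  rfl

-- Compare the coefficients of `Z` in the Jacobi identity for `X`, `Y` and `f • Z`.
theorem dirDeriv_mlieBracket (hX : CMDiff ∞ (T% X)) (hY : CMDiff ∞ (T% Y)) (hf : CMDiff ∞ f)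
    (x : M) :
    dirDeriv (mlieBracket I X Y) f x =
      dirDeriv X (dirDeriv Y f) x - dirDeriv Y (dirDeriv X f) x := by
  rcases subsingleton_or_nontrivial (TangentSpace I x) with hs | hs
  · simp [dirDeriv, Subsingleton.elim (X x) 0, Subsingleton.elim (Y x) 0,
      Subsingleton.elim (mlieBracket I X Y x) 0]
  obtain ⟨v, hv⟩ := exists_ne (0 : TangentSpace I x)
  obtain ⟨Z, hZ, rfl⟩ := exists_contMDiff_eq v
  have hJacobi := mlieBracket_jacobi hX hY (hf.smul_section hZ) x
  rw [mlieBracket_mlieBracket_smul_section X hY hZ hf,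
    mlieBracket_mlieBracket_smul_section Y hX hZ hf, mlieBracket_smul_section_right hf hZ,
    Pi.add_apply, Pi.smul_apply', Pi.smul_apply', mlieBracket_jacobi hX hY hZ x] at hJacobi
  have hZx : (dirDeriv X (dirDeriv Y f) x - dirDeriv Y (dirDeriv X f) x -
      dirDeriv (mlieBracket I X Y) f x) • Z x = 0 := by
    rw [← sub_eq_zero] at hJacobi
    rw [← hJacobi]
    module
  exact (sub_eq_zero.1 ((smul_eq_zero.1 hZx).resolve_right hv)).symm

end VectorFields

theorem nonpos_of_isLocalMax_of_hasDerivAt {φ φ' : ℝ → ℝ} {a t : ℝ}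
    (hφ : ∀ᶠ s in 𝓝 t, HasDerivAt φ (φ' s) s) (hφ' : HasDerivAt φ' a t) (hmax : IsLocalMax φ t) :
    a ≤ 0 := by
  by_contra! ha
  have hderiv : deriv φ =ᶠ[𝓝 t] φ' := hφ.mono fun s hs ↦ hs.deriv
  have hderiv₂ : deriv (deriv φ) t = a := by rw [hderiv.deriv_eq, hφ'.deriv]
  have hmin : IsLocalMin φ t := isLocalMin_of_deriv_deriv_pos (hderiv₂.symm ▸ ha)
    hmax.deriv_eq_zero hφ.self_of_nhds.continuousAt
  have hconst : φ =ᶠ[𝓝 t] fun _ ↦ φ t := by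
    filter_upwards [hmax, hmin] with s h h' using le_antisymm h h'
  have hderiv_zero : deriv φ =ᶠ[𝓝 t] fun _ ↦ 0 := by
    filter_upwards [hconst.eventuallyEq_nhds] with s hs
    rw [hs.deriv_eq, deriv_const]
  rw [hderiv_zero.deriv_eq, deriv_const] at hderiv₂
  exact ha.ne hderiv₂

theorem exists_contDiff_fderiv_ne_zero_lt {F : Type*} [NormedAddCommGroup F]
    [InnerProductSpace ℝ F] [FiniteDimensional ℝ F] {C : Set F} (hC : IsClosed C) {a : F}
    (ha : a ∈ C) (hint : a ∉ interior C) {r : ℝ} (hr : 0 < r) :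
    ∃ z ∈ C, dist z a < r ∧ ∃ φ : F → ℝ, ContDiff ℝ ∞ φ ∧ fderiv ℝ φ z ≠ 0 ∧
      ∀ p ∈ C, p ≠ z → φ z < φ p := by
  obtain ⟨y, hya, hyC⟩ : ∃ y, dist y a < r / 2 ∧ y ∉ C := by
    by_contra! h
    exact hint (mem_interior_iff_mem_nhds.2 (Metric.mem_nhds_iff.2 ⟨r / 2, half_pos hr, h⟩))
  obtain ⟨z, hzC, hz⟩ := hC.exists_infDist_eq_dist ⟨a, ha⟩ y
  have hmin : ∀ p ∈ C, dist y z ≤ dist y p := fun p hp ↦ hz ▸ Metric.infDist_le_dist_of_mem hp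
  have hzy : z - y ≠ 0 := sub_ne_zero.2 fun h ↦ hyC (h ▸ hzC)
  refine ⟨z, hzC, ?_, fun p ↦ ‖p - y‖ ^ 2 + ‖p - z‖ ^ 2, ?_, fun h ↦ ?_, fun p hp hpz ↦ ?_⟩
  · linarith [dist_triangle_left z a y, hmin a ha]
  · exact ((contDiff_id.sub contDiff_const).norm_sq ℝ).add
      ((contDiff_id.sub contDiff_const).norm_sq ℝ)
  · have hderiv (c : F) := ((hasFDerivAt_id (𝕜 := ℝ) z).sub_const c).norm_sq
    have hzero : inner ℝ (z - y) (z - y) = 0 := by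
      rw [inner_sub_left]
      simpa [inner_sub_left] using
        DFunLike.congr_fun (((hderiv y).add (hderiv z)).fderiv.symm.trans h) (z - y)
    exact hzy (inner_self_eq_zero.1 hzero)
  · have hle := hmin p hp
    rw [dist_eq_norm', dist_eq_norm'] at hle
    have hpos : 0 < ‖p - z‖ := norm_pos_iff.2 (sub_ne_zero.2 hpz)
    simp only [sub_self, norm_zero]
    nlinarith [norm_nonneg (z - y)]

section LocalAnalysis

variable {E : Type*} [NormedAddCommGroup E] [NormedSpace ℝ E] [FiniteDimensional ℝ E]
  {H : Type*} [TopologicalSpace H] {I : ModelWithCorners ℝ E H}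
  {M : Type*} [TopologicalSpace M] [ChartedSpace H M] [IsManifold I ∞ M]
  {f : M → ℝ} {X : Π x : M, TangentSpace I x} {x : M}

theorem exists_openPartialHomeomorph_contMDiffOn [I.Boundaryless] (x : M) :
    ∃ Φ : OpenPartialHomeomorph M (EuclideanSpace ℝ (Fin (finrank ℝ E))), x ∈ Φ.source ∧
      CMDiff[Φ.source] ∞ Φ ∧ CMDiff[Φ.target] ∞ Φ.symm := by
  have hchart : CMDiff[(extChartAt I x).source] ∞ (extChartAt I x) := by
    simpa only [extChartAt_source] using contMDiffOn_extChartAt (I := I) (x := x) (n := ∞)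
  have hΦ : CMDiff[(extChartAt I x).source] ∞ (toEuclidean ∘ extChartAt I x) :=
    toEuclidean.contDiff.contMDiff.comp_contMDiffOn hchart
  have hΦsymm : CMDiff[toEuclidean.symm ⁻¹' (extChartAt I x).target] ∞
      ((extChartAt I x).symm ∘ toEuclidean.symm) :=
    (contMDiffOn_extChartAt_symm x).comp toEuclidean.symm.contDiff.contMDiff.contMDiffOn
      fun p hp ↦ hp
  exact ⟨{  toPartialEquiv := (extChartAt I x).transEquiv toEuclidean.toEquiv
            open_source := isOpen_extChartAt_source x
            open_target := (isOpen_extChartAt_target x).preimage toEuclidean.symm.continuous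
            continuousOn_toFun := hΦ.continuousOn
            continuousOn_invFun := hΦsymm.continuousOn },
    mem_extChartAt_source x, hΦ, hΦsymm⟩

theorem exists_curve_hasDerivAt [BoundarylessManifold I M] (hX : CMDiff ∞ (T% X)) (x : M) :
    ∃ γ : ℝ → M, γ 0 = x ∧ ContinuousAt γ 0 ∧ ∀ f : M → ℝ, CMDiff ∞ f →
      ∀ᶠ t in 𝓝 0, HasDerivAt (f ∘ γ) (dirDeriv X f (γ t)) t := by
  obtain ⟨γ, hγ0, hγ⟩ := exists_isMIntegralCurveAt_of_contMDiffAt_boundaryless (I := I) 0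
    ((hX x).of_le ENat.LEInfty.out)
  have hγ' : ∀ᶠ t in 𝓝 (0 : ℝ), HasMFDerivAt 𝓘(ℝ, ℝ) I γ t
    ((1 : ℝ →L[ℝ] ℝ).smulRight <| X (γ t)) := hγ
  refine ⟨γ, hγ0, hγ'.self_of_nhds.continuousAt, fun f hf ↦ ?_⟩
  filter_upwards [hγ'] with t ht
  have key (A : ℝ →L[ℝ] ℝ) (h : HasFDerivAt (f ∘ γ) A t) : HasDerivAt (f ∘ γ) (A 1) t :=
    h.hasDerivAt
  have h := key _ ((mdiffAt_of_contMDiff hf (γ t)).hasMFDerivAt.comp t ht).hasFDerivAt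
  have hone : ((1 : ℝ →L[ℝ] ℝ).smulRight (X (γ t)) : ℝ →L[ℝ] TangentSpace I (γ t)) 1 = X (γ t) :=
    one_smul ℝ _
  exact (congrArg (fun v ↦ HasDerivAt (f ∘ γ) (d% f (γ t) v) t) hone).mp h

theorem dirDeriv_eq_zero_of_isLocalMax [BoundarylessManifold I M] (hf : CMDiff ∞ f)
    (hX : CMDiff ∞ (T% X)) (hmax : IsLocalMax f x) : dirDeriv X f x = 0 := by
  obtain ⟨γ, rfl, hγc, hγ⟩ := exists_curve_hasDerivAt hX x
  have h : IsLocalMax (f ∘ γ) 0 := hmax.comp_tendsto hγc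
  exact h.hasDerivAt_eq_zero (hγ f hf).self_of_nhds

theorem dirDeriv_dirDeriv_nonpos_of_isLocalMax [BoundarylessManifold I M] (hf : CMDiff ∞ f)
    (hX : CMDiff ∞ (T% X)) (hmax : IsLocalMax f x) : dirDeriv X (dirDeriv X f) x ≤ 0 := by
  obtain ⟨γ, rfl, hγc, hγ⟩ := exists_curve_hasDerivAt hX x
  exact nonpos_of_isLocalMax_of_hasDerivAt (hγ f hf)
    (hγ (dirDeriv X f) (contMDiff_dirDeriv hX hf)).self_of_nhds
    (hmax.comp_tendsto hγc : IsLocalMax (f ∘ γ) 0)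

variable [T2Space M]

theorem exists_contMDiff_eventuallyEq_of_contMDiffOn {U : Set M} (hU : IsOpen U) (hx : x ∈ U)
    (hf : CMDiff[U] ∞ f) : ∃ g : M → ℝ, CMDiff ∞ g ∧ g =ᶠ[𝓝 x] f := by
  obtain ⟨ψ, -, hψ⟩ := (SmoothBumpFunction.nhds_basis_tsupport (I := I) x).mem_iff.1
    (hU.mem_nhds hx)
  refine ⟨fun y ↦ ψ y • f y, contMDiff_of_tsupport fun y hy ↦ ?_, ?_⟩
  · have hyU : y ∈ U := hψ (tsupport_smul_subset_left _ _ hy)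
    exact ψ.contMDiffAt.smul ((hf y hyU).contMDiffAt (hU.mem_nhds hyU))
  · filter_upwards [ψ.eventuallyEq_one] with y hy
    rw [hy, Pi.one_apply, one_smul]

end LocalAnalysis

section Riemannian

variable {E : Type*} [NormedAddCommGroup E] [NormedSpace ℝ E]
  {H : Type*} [TopologicalSpace H] {I : ModelWithCorners ℝ E H}
  {M : Type*} [TopologicalSpace M] [ChartedSpace H M] [IsManifold I ∞ M]
  [RiemannianBundle (fun x : M ↦ TangentSpace I x)]
  [IsContMDiffRiemannianBundle I ∞ E (fun x : M ↦ TangentSpace I x)]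

theorem contMDiff_inner {X Y : Π x : M, TangentSpace I x}
    (hX : CMDiff ∞ (T% X)) (hY : CMDiff ∞ (T% Y)) : CMDiff ∞ (fun y : M ↦ inner ℝ (X y) (Y y)) :=
  ContMDiff.inner_bundle (IB := I) (F := E) (E := fun x : M ↦ TangentSpace I x) hX hY

open InnerProductSpace in
theorem contMDiffOn_gramSchmidt {ι : Type*} [LinearOrder ι] [LocallyFiniteOrderBot ι]
    [WellFoundedLT ι] {s : ι → Π x : M, TangentSpace I x} {u : Set M}
    (hs : ∀ i, CMDiff[u] ∞ (T% (s i))) (hli : ∀ y ∈ u, LinearIndependent ℝ (fun i ↦ s i y))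
    (i : ι) : CMDiff[u] ∞ (T% (fun y : M ↦ gramSchmidt ℝ (fun j ↦ s j y) i)) := by
  induction i using WellFoundedLT.induction with
  | ind i ih =>
    have h (y : M) : gramSchmidt ℝ (fun j ↦ s j y) i = s i y - ∑ j ∈ Finset.Iio i,
        (inner ℝ (gramSchmidt ℝ (fun k ↦ s k y) j) (s i y) /
          inner ℝ (gramSchmidt ℝ (fun k ↦ s k y) j) (gramSchmidt ℝ (fun k ↦ s k y) j)) •
            gramSchmidt ℝ (fun k ↦ s k y) j := by
      rw [eq_sub_iff_add_eq]
      simpa [real_inner_self_eq_norm_sq] using (gramSchmidt_def'' ℝ (fun j ↦ s j y) i).symm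
    simp only [h]
    refine (hs i).sub_section (ContMDiffOn.sum_section fun j hj ↦ ?_)
    have hj' := ih j (Finset.mem_Iio.1 hj)
    refine ContMDiffOn.smul_section (ContMDiffOn.div₀ ?_ ?_ ?_) hj'
    · exact ContMDiffOn.inner_bundle (E := fun x : M ↦ TangentSpace I x) hj' (hs i)
    · exact ContMDiffOn.inner_bundle (E := fun x : M ↦ TangentSpace I x) hj' hj'
    · exact fun y hy ↦ inner_self_ne_zero.2 (gramSchmidt_ne_zero _ (hli y hy))

theorem contMDiffOn_norm {X : Π x : M, TangentSpace I x} {u : Set M} (hX : CMDiff[u] ∞ (T% X))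
    (h0 : ∀ y ∈ u, X y ≠ 0) : CMDiff[u] ∞ (fun y ↦ ‖X y‖) := by
  have hsq := ContMDiffOn.inner_bundle (E := fun x : M ↦ TangentSpace I x) hX hX
  simp only [norm_eq_sqrt_real_inner]
  exact fun y hy ↦ ContMDiffAt.comp_contMDiffWithinAt y
    (Real.contDiffAt_sqrt (inner_self_ne_zero.2 (h0 y hy))).contMDiffAt (hsq y hy)

open InnerProductSpace in
theorem contMDiffOn_gramSchmidtNormed {ι : Type*} [LinearOrder ι] [LocallyFiniteOrderBot ι]
    [WellFoundedLT ι] {s : ι → Π x : M, TangentSpace I x} {u : Set M}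
    (hs : ∀ i, CMDiff[u] ∞ (T% (s i))) (hli : ∀ y ∈ u, LinearIndependent ℝ (fun i ↦ s i y))
    (i : ι) : CMDiff[u] ∞ (T% (fun y : M ↦ gramSchmidtNormed ℝ (fun j ↦ s j y) i)) := by
  have hne (y : M) (hy : y ∈ u) : gramSchmidt ℝ (fun j ↦ s j y) i ≠ 0 :=
    gramSchmidt_ne_zero _ (hli y hy)
  have h := contMDiffOn_gramSchmidt hs hli i
  exact ((contMDiffOn_norm h hne).inv₀ fun y hy ↦ norm_ne_zero_iff.2 (hne y hy)).smul_section h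

/-- Global smooth vector fields that form an orthonormal basis of the tangent space at every point
near `x`. -/
structure IsOrthonormalFrameNear (e : Fin (finrank ℝ E) → Π x : M, TangentSpace I x) (x : M) :
    Prop where
  contMDiff : ∀ i, CMDiff ∞ (T% (e i))
  eventually_exists_basis : ∀ᶠ y in 𝓝 x,
    ∃ b : OrthonormalBasis (Fin (finrank ℝ E)) ℝ (TangentSpace I y), ∀ i, b i = e i y

variable [FiniteDimensional ℝ E]

theorem exists_isOrthonormalFrameNear [T2Space M] (x : M) :
    ∃ e : Fin (finrank ℝ E) → Π x : M, TangentSpace I x, IsOrthonormalFrameNear e x := by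
  let t := trivializationAt E (TangentSpace I : M → Type _) x
  have hx : x ∈ t.baseSet := FiberBundle.mem_baseSet_trivializationAt' x
  have hs : IsLocalFrameOn I E ∞ (t.localFrame (finBasis ℝ E)) t.baseSet :=
    t.isLocalFrameOn_localFrame_baseSet I ∞ (finBasis ℝ E)
  have hli (y : M) (hy : y ∈ t.baseSet) := hs.linearIndependent hy
  choose e he hee using fun i ↦ exists_contMDiff_eventuallyEq t.open_baseSet hx
    (contMDiffOn_gramSchmidtNormed hs.contMDiffOn hli i)
  refine ⟨e, he, ?_⟩
  filter_upwards [t.open_baseSet.mem_nhds hx, eventually_all.2 hee] with y hy hye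
  simp only [hye]
  exact exists_orthonormalBasis_eq
    (InnerProductSpace.gramSchmidtNormed_orthonormal (hli y hy)) (Fintype.card_fin _)

attribute [local instance] isManifold_infty_add_one isManifold_minSmoothness_two
  isManifold_minSmoothness_three

variable {f g : M → ℝ} {X X' Y Y' Z Z' W : Π x : M, TangentSpace I x} {x : M}

/-! ### Covariant derivatives and traces -/

/-- The covariant derivative `∇_X Y` for the Levi-Civita connection. -/
def covDeriv (X Y : Π x : M, TangentSpace I x) (x : M) : TangentSpace I x :=
  leviCivita I M Y x (X x)

theorem covDeriv_smul_left (f : M → ℝ) (X Y : Π x : M, TangentSpace I x) (x : M) :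
    covDeriv (f • X) Y x = f x • covDeriv X Y x :=
  map_smul _ _ _

theorem covDeriv_add_left (X X' Y : Π x : M, TangentSpace I x) (x : M) :
    covDeriv (X + X') Y x = covDeriv X Y x + covDeriv X' Y x :=
  map_add _ _ _

theorem leviCivita_add (hY : MDiffAt (T% Y) x) (hY' : MDiffAt (T% Y') x) (u : TangentSpace I x) :
    leviCivita I M (Y + Y') x u = leviCivita I M Y x u + leviCivita I M Y' x u :=
  DFunLike.congr_fun ((leviCivita I M).isCovariantDerivativeOnUniv.add hY hY') u

theorem leviCivita_smul (hf : MDiffAt f x) (hY : MDiffAt (T% Y) x) (u : TangentSpace I x) :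
    leviCivita I M (f • Y) x u = f x • leviCivita I M Y x u + d% f x u • Y x :=
  DFunLike.congr_fun ((leviCivita I M).isCovariantDerivativeOnUniv.leibniz hY hf) u

theorem covDeriv_add (X : Π x : M, TangentSpace I x) (hY : MDiffAt (T% Y) x)
    (hY' : MDiffAt (T% Y') x) : covDeriv X (Y + Y') x = covDeriv X Y x + covDeriv X Y' x :=
  leviCivita_add hY hY' (X x)

theorem covDeriv_smul (X : Π x : M, TangentSpace I x) (hf : MDiffAt f x) (hY : MDiffAt (T% Y) x) :
    covDeriv X (f • Y) x = f x • covDeriv X Y x + dirDeriv X f x • Y x :=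
  leviCivita_smul hf hY (X x)

theorem covDeriv_neg (X : Π x : M, TangentSpace I x) (hY : MDiffAt (T% Y) x) :
    covDeriv X (-Y) x = -covDeriv X Y x := by
  have hneg : -Y = (fun _ : M ↦ (-1 : ℝ)) • Y := by
    ext y
    simp
  rw [hneg, covDeriv_smul X mdifferentiableAt_const hY, dirDeriv_const]
  module

theorem covDeriv_sub (X : Π x : M, TangentSpace I x) (hY : MDiffAt (T% Y) x)
    (hY' : MDiffAt (T% Y') x) : covDeriv X (Y - Y') x = covDeriv X Y x - covDeriv X Y' x := by
  rw [sub_eq_add_neg, covDeriv_add X hY (mdifferentiableAt_neg_section hY'), covDeriv_neg X hY',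
    sub_eq_add_neg]

theorem covDeriv_congr (hY : MDiffAt (T% Y) x) (hYY' : ∀ᶠ y in 𝓝 x, Y y = Y' y)
    (hXX' : X x = X' x) : covDeriv X Y x = covDeriv X' Y' x := by
  have hY' : MDiffAt (T% Y') x :=
    hY.congr_of_eventuallyEq (hYY'.mono fun y hy ↦ by simp only [hy])
  rw [covDeriv, covDeriv, hXX',
    (leviCivita I M).isCovariantDerivativeOnUniv.congr_of_eventuallyEq hY hY' univ_mem hYY']

theorem covDeriv_sub_covDeriv (hX : MDiffAt (T% X) x) (hY : MDiffAt (T% Y) x) :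
    covDeriv X Y x - covDeriv Y X x = mlieBracket I X Y x :=
  (CovariantDerivative.torsion_eq_zero_iff _).1 leviCivita_torsion hX hY

theorem dirDeriv_inner (hX : MDiffAt (T% X) x) (hY : MDiffAt (T% Y) x) (hZ : MDiffAt (T% Z) x) :
    dirDeriv X (fun y : M ↦ inner ℝ (Y y) (Z y)) x =
      inner ℝ (covDeriv X Y x) (Z x) + inner ℝ (Y x) (covDeriv X Z x) :=
  leviCivita_metric hX hY hZ

theorem eventually_covDeriv_eq (hY : CMDiff ∞ (T% Y)) (hYY' : ∀ᶠ y in 𝓝 x, Y y = Y' y)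
    (hXX' : ∀ᶠ y in 𝓝 x, X y = X' y) : ∀ᶠ y in 𝓝 x, covDeriv X Y y = covDeriv X' Y' y := by
  filter_upwards [hYY'.eventually_nhds, hXX'] with y hy hXy
  exact covDeriv_congr (mdiffAt_of_contMDiff hY y) hy hXy

theorem curvature_apply (X Y Z : Π x : M, TangentSpace I x) (x : M) :
    curvature X Y Z x = covDeriv X (covDeriv Y Z) x - covDeriv Y (covDeriv X Z) x -
      covDeriv (mlieBracket I X Y) Z x := rfl

theorem covDeriv_covDeriv_comm (hX : CMDiff ∞ (T% X)) (hY : CMDiff ∞ (T% Y))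
    (Z : Π x : M, TangentSpace I x) (x : M) :
    covDeriv X (covDeriv Y Z) x = curvature X Y Z x + covDeriv Y (covDeriv X Z) x +
      (leviCivita I M Z x (covDeriv X Y x) - leviCivita I M Z x (covDeriv Y X x)) := by
  rw [curvature_apply, ← map_sub,
    covDeriv_sub_covDeriv (mdiffAt_of_contMDiff hX x) (mdiffAt_of_contMDiff hY x), covDeriv,
    covDeriv, covDeriv]
  abel

theorem curvature_swap (X Y Z : Π x : M, TangentSpace I x) (x : M) :
    curvature X Y Z x = -curvature Y X Z x := by
  have h : covDeriv (mlieBracket I X Y) Z x = -covDeriv (mlieBracket I Y X) Z x := by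
    rw [covDeriv, mlieBracket_swap_apply, map_neg, covDeriv]
  rw [curvature_apply, curvature_apply, h]
  abel

theorem curvatureAt_swap (u v w : TangentSpace I x) :
    curvatureAt x u v w = -curvatureAt x v u w :=
  curvature_swap _ _ _ _

omit [IsManifold I ∞ M] [IsContMDiffRiemannianBundle I ∞ E (fun x : M ↦ TangentSpace I x)] in
theorem metricTrace_eq_sum {ι : Type*} [Fintype ι]
    (B : TangentSpace I x →ₗ[ℝ] TangentSpace I x →ₗ[ℝ] ℝ)
    (b : OrthonormalBasis ι ℝ (TangentSpace I x)) :
    metricTrace (fun u v ↦ B u v) = ∑ i, B (b i) (b i) :=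
  sum_bilin_orthonormalBasis_eq B b _

omit [IsManifold I ∞ M] [IsContMDiffRiemannianBundle I ∞ E (fun x : M ↦ TangentSpace I x)] in
theorem dirDeriv_eq_inner_gradient (X : Π x : M, TangentSpace I x) (f : M → ℝ) (x : M) :
    dirDeriv X f x = inner ℝ (gradient I f x) (X x) := by
  simp [dirDeriv, gradient]

/-- The divergence `tr ∇Y` of a vector field. -/
def divergence (Y : Π x : M, TangentSpace I x) (x : M) : ℝ :=
  metricTrace fun u v ↦ inner ℝ (leviCivita I M Y x u) v

/-- The covariant derivative of a vector field as the bilinear form `(u, v) ↦ g(∇_u Y, v)`. -/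
def covDerivForm (Y : Π x : M, TangentSpace I x) (x : M) :
    TangentSpace I x →ₗ[ℝ] TangentSpace I x →ₗ[ℝ] ℝ :=
  (innerₗ (TangentSpace I x)).comp
    (leviCivita I M Y x : TangentSpace I x →ₗ[ℝ] TangentSpace I x)

theorem divergence_eq_sum {ι : Type*} [Fintype ι] (b : OrthonormalBasis ι ℝ (TangentSpace I x))
    (Y : Π x : M, TangentSpace I x) :
    divergence Y x = ∑ i, inner ℝ (leviCivita I M Y x (b i)) (b i) :=
  metricTrace_eq_sum (covDerivForm Y x) b

theorem divergence_add (hY : MDiffAt (T% Y) x) (hY' : MDiffAt (T% Y') x) :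
    divergence (Y + Y') x = divergence Y x + divergence Y' x := by
  simp only [divergence, metricTrace, leviCivita_add hY hY', inner_add_left,
    Finset.sum_add_distrib]

theorem divergence_smul (hf : MDiffAt f x) (hY : MDiffAt (T% Y) x) :
    divergence (f • Y) x = f x * divergence Y x + inner ℝ (gradient I f x) (Y x) := by
  have hgrad (u : TangentSpace I x) : d% f x u = inner ℝ (gradient I f x) u := by simp [gradient]
  rw [← (stdOrthonormalBasis ℝ (TangentSpace I x)).sum_inner_mul_inner]
  simp only [divergence, metricTrace, leviCivita_smul hf hY, inner_add_left, real_inner_smul_left,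
    Finset.sum_add_distrib, Finset.mul_sum, hgrad]
  simp only [real_inner_comm (Y x)]

theorem divergence_const_smul (c : ℝ) (hY : MDiffAt (T% Y) x) :
    divergence ((fun _ : M ↦ c) • Y) x = c * divergence Y x := by
  rw [divergence_smul mdifferentiableAt_const hY, ← dirDeriv_eq_inner_gradient, dirDeriv_const,
    add_zero]

theorem metricTrace_leviCivita_add_smul (Y : Π x : M, TangentSpace I x) (c : ℝ) (x : M) :
    metricTrace (fun u v ↦ inner ℝ (leviCivita I M Y x u + c • u) (leviCivita I M Y x v + c • v)) =
      metricTrace (fun u v ↦ inner ℝ (leviCivita I M Y x u) (leviCivita I M Y x v)) +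
        2 * c * divergence Y x + (finrank ℝ E : ℝ) * (c * c) := by
  have hunit (i) : inner ℝ (stdOrthonormalBasis ℝ (TangentSpace I x) i)
      (stdOrthonormalBasis ℝ (TangentSpace I x) i) = (1 : ℝ) :=
    inner_self_eq_one_of_norm_eq_one ((stdOrthonormalBasis ℝ (TangentSpace I x)).norm_eq_one i)
  have hrank : finrank ℝ (TangentSpace I x) = finrank ℝ E := rfl
  simp only [divergence, metricTrace, inner_add_left, inner_add_right, real_inner_smul_left,
    real_inner_smul_right, Finset.sum_add_distrib, ← Finset.mul_sum, hunit, hrank,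
    real_inner_comm (leviCivita I M Y x _) (stdOrthonormalBasis ℝ _ _),
    Finset.sum_const, Finset.card_univ, Fintype.card_fin, nsmul_eq_mul, mul_one]
  ring

theorem laplacian_eq_neg_divergence (f : M → ℝ) (x : M) :
    laplacian I f x = -divergence (gradient I f) x := rfl

theorem contMDiff_koszul (hX : CMDiff ∞ (T% X)) (hY : CMDiff ∞ (T% Y)) (hZ : CMDiff ∞ (T% Z)) :
    CMDiff ∞ (koszul (I := I) Y X Z) := by
  have hXYZ := contMDiff_dirDeriv hX (contMDiff_inner hY hZ)
  have hYXZ := contMDiff_dirDeriv hY (contMDiff_inner hX hZ)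
  have hZXY := contMDiff_dirDeriv hZ (contMDiff_inner hX hY)
  have hbXY := contMDiff_inner (contMDiff_mlieBracket hX hY) hZ
  have hbXZ := contMDiff_inner (contMDiff_mlieBracket hX hZ) hY
  have hbYZ := contMDiff_inner (contMDiff_mlieBracket hY hZ) hX
  exact contMDiff_const.mul (((((hXYZ.add hYXZ).sub hZXY).add hbXY).sub hbXZ).sub hbYZ)

theorem IsOrthonormalFrameNear.inner_covDeriv_add_inner_covDeriv_eq_zero
    {e : Fin (finrank ℝ E) → Π x : M, TangentSpace I x} (he : IsOrthonormalFrameNear e x)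
    (hX : MDiffAt (T% X) x) (i j : Fin (finrank ℝ E)) :
    inner ℝ (covDeriv X (e i) x) (e j x) + inner ℝ (e i x) (covDeriv X (e j) x) = 0 := by
  have hconst : (fun y : M ↦ (inner ℝ (e i y) (e j y) : ℝ)) =ᶠ[𝓝 x]
      fun _ ↦ if i = j then 1 else 0 := by
    filter_upwards [he.eventually_exists_basis] with y ⟨b, hb⟩
    rw [← hb, ← hb, b.inner_eq_ite]
  rw [← dirDeriv_inner hX (mdiffAt_of_contMDiff (he.contMDiff i) x)
    (mdiffAt_of_contMDiff (he.contMDiff j) x), dirDeriv_congr hconst, dirDeriv_const]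

-- The frame is not parallel, but it only rotates, which the trace does not notice.
theorem IsOrthonormalFrameNear.dirDeriv_metricTrace
    {e : Fin (finrank ℝ E) → Π x : M, TangentSpace I x} (he : IsOrthonormalFrameNear e x)
    (hX : MDiffAt (T% X) x) {B : Π x : M, TangentSpace I x →ₗ[ℝ] TangentSpace I x →ₗ[ℝ] ℝ}
    (hB : ∀ i, CMDiff ∞ (fun y : M ↦ B y (e i y) (e i y))) :
    dirDeriv X (fun y : M ↦ metricTrace fun u v ↦ B y u v) x =
      ∑ i, (dirDeriv X (fun y : M ↦ B y (e i y) (e i y)) x -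
        (B x (covDeriv X (e i) x) (e i x) + B x (e i x) (covDeriv X (e i) x))) := by
  obtain ⟨b, hb⟩ := he.eventually_exists_basis.self_of_nhds
  have htrace : (fun y : M ↦ metricTrace fun u v ↦ B y u v) =ᶠ[𝓝 x]
      fun y ↦ ∑ i, B y (e i y) (e i y) := by
    filter_upwards [he.eventually_exists_basis] with y ⟨b, hb⟩
    simp only [metricTrace_eq_sum (B y) b, hb]
  have hskew := sum_bilin_add_bilin_eq_zero_of_skew (B x) b
    (w := fun i ↦ covDeriv X (e i) x) fun i j ↦ by
      rw [hb, hb, he.inner_covDeriv_add_inner_covDeriv_eq_zero hX]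
  simp only [hb] at hskew
  rw [dirDeriv_congr htrace, dirDeriv_sum X hB, Finset.sum_sub_distrib, hskew, sub_zero]

variable [T2Space M]

theorem contMDiff_of_contMDiff_inner
    (h : ∀ Z : Π x : M, TangentSpace I x, CMDiff ∞ (T% Z) →
      CMDiff ∞ (fun y : M ↦ inner ℝ (Z y) (X y))) : CMDiff ∞ (T% X) := by
  intro x
  obtain ⟨e, he⟩ := exists_isOrthonormalFrameNear (I := I) x
  have hsum : CMDiffAt ∞ (T% (fun y : M ↦ ∑ i, (inner ℝ (e i y) (X y) : ℝ) • e i y)) x :=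
    ContMDiffAt.sum_section fun i _ ↦
      ContMDiffAt.smul_section (h _ (he.contMDiff i) x) (he.contMDiff i x)
  refine hsum.congr_of_eventuallyEq ?_
  filter_upwards [he.eventually_exists_basis] with y ⟨b, hb⟩
  simp only [← hb, b.sum_repr']

theorem contMDiff_covDeriv (hX : CMDiff ∞ (T% X)) (hY : CMDiff ∞ (T% Y)) :
    CMDiff ∞ (T% (covDeriv X Y)) := by
  refine contMDiff_of_contMDiff_inner fun Z hZ ↦ (contMDiff_koszul hX hY hZ).congr fun y ↦ ?_
  rw [real_inner_comm]
  exact inner_leviCivitaFun (mdiffAt_of_contMDiff hY y) (mdiffAt_of_contMDiff hX y)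
    (mdiffAt_of_contMDiff hZ y)

theorem mdiffAt_covDeriv (hX : MDiffAt (T% X) x) (hY : CMDiff ∞ (T% Y)) :
    MDiffAt (T% (covDeriv X Y)) x := by
  obtain ⟨e, he⟩ := exists_isOrthonormalFrameNear (I := I) x
  have hsum : MDiffAt (T% (fun y : M ↦ ∑ i, (inner ℝ (e i y) (X y) : ℝ) • covDeriv (e i) Y y)) x :=
    MDifferentiableAt.sum_section fun i _ ↦
      (mdiffAt_inner (mdiffAt_of_contMDiff (he.contMDiff i) x) hX).smul_section
        (mdiffAt_of_contMDiff (contMDiff_covDeriv (he.contMDiff i) hY) x)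
  refine hsum.congr_of_eventuallyEq ?_
  filter_upwards [he.eventually_exists_basis] with y ⟨b, hb⟩
  simp only [covDeriv, ← hb]
  exact congrArg (TotalSpace.mk' E y)
    (map_eq_sum_inner_smul b (leviCivita I M Y y : TangentSpace I y →ₗ[ℝ] TangentSpace I y) (X y))

/-! ### The curvature tensor -/

theorem contMDiff_curvature (hX : CMDiff ∞ (T% X)) (hY : CMDiff ∞ (T% Y)) (hZ : CMDiff ∞ (T% Z)) :
    CMDiff ∞ (T% (curvature X Y Z)) :=
  ((contMDiff_covDeriv hX (contMDiff_covDeriv hY hZ)).sub_section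
    (contMDiff_covDeriv hY (contMDiff_covDeriv hX hZ))).sub_section
      (contMDiff_covDeriv (contMDiff_mlieBracket hX hY) hZ)

theorem dirDeriv_dirDeriv_inner (hX : CMDiff ∞ (T% X)) (hY : CMDiff ∞ (T% Y))
    (hZ : CMDiff ∞ (T% Z)) (hW : CMDiff ∞ (T% W)) (x : M) :
    dirDeriv X (dirDeriv Y (fun y : M ↦ inner ℝ (Z y) (W y))) x =
      inner ℝ (covDeriv X (covDeriv Y Z) x) (W x) + inner ℝ (covDeriv Y Z x) (covDeriv X W x) +
        (inner ℝ (covDeriv X Z x) (covDeriv Y W x) +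
          inner ℝ (Z x) (covDeriv X (covDeriv Y W) x)) := by
  have hYZ := contMDiff_covDeriv hY hZ
  have hYW := contMDiff_covDeriv hY hW
  have h : dirDeriv Y (fun y : M ↦ inner ℝ (Z y) (W y)) =
      fun y : M ↦ inner ℝ (covDeriv Y Z y) (W y) + inner ℝ (Z y) (covDeriv Y W y) :=
    funext fun y ↦ dirDeriv_inner (mdiffAt_of_contMDiff hY y) (mdiffAt_of_contMDiff hZ y)
      (mdiffAt_of_contMDiff hW y)
  have hX' := mdiffAt_of_contMDiff hX x
  rw [h, dirDeriv_add X (mdiffAt_of_contMDiff (contMDiff_inner hYZ hW) x)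
      (mdiffAt_of_contMDiff (contMDiff_inner hZ hYW) x),
    dirDeriv_inner hX' (mdiffAt_of_contMDiff hYZ x) (mdiffAt_of_contMDiff hW x),
    dirDeriv_inner hX' (mdiffAt_of_contMDiff hZ x) (mdiffAt_of_contMDiff hYW x)]

theorem inner_curvature_swap (hX : CMDiff ∞ (T% X)) (hY : CMDiff ∞ (T% Y)) (hZ : CMDiff ∞ (T% Z))
    (hW : CMDiff ∞ (T% W)) (x : M) :
    inner ℝ (curvature X Y Z x) (W x) = -inner ℝ (curvature X Y W x) (Z x) := by
  have h := dirDeriv_mlieBracket hX hY (contMDiff_inner hZ hW) x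
  rw [dirDeriv_dirDeriv_inner hX hY hZ hW, dirDeriv_dirDeriv_inner hY hX hZ hW,
    dirDeriv_inner (mdiffAt_of_contMDiff (contMDiff_mlieBracket hX hY) x)
      (mdiffAt_of_contMDiff hZ x) (mdiffAt_of_contMDiff hW x)] at h
  simp only [curvature_apply, inner_sub_left]
  simp only [real_inner_comm (Z x)] at h ⊢
  linarith

theorem covDeriv_covDeriv_sub_eq_mlieBracket (hX : CMDiff ∞ (T% X)) (hY : CMDiff ∞ (T% Y))
    (hZ : CMDiff ∞ (T% Z)) (x : M) :
    covDeriv X (covDeriv Y Z) x - covDeriv X (covDeriv Z Y) x - covDeriv (mlieBracket I Y Z) X x =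
      mlieBracket I X (mlieBracket I Y Z) x := by
  have h : mlieBracket I Y Z = covDeriv Y Z - covDeriv Z Y :=
    funext fun y ↦ (covDeriv_sub_covDeriv (mdiffAt_of_contMDiff hY y)
      (mdiffAt_of_contMDiff hZ y)).symm
  rw [← covDeriv_sub_covDeriv (mdiffAt_of_contMDiff hX x)
      (mdiffAt_of_contMDiff (contMDiff_mlieBracket hY hZ) x),
    ← covDeriv_sub X (mdiffAt_of_contMDiff (contMDiff_covDeriv hY hZ) x)
      (mdiffAt_of_contMDiff (contMDiff_covDeriv hZ hY) x), ← h]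

theorem curvature_bianchi (hX : CMDiff ∞ (T% X)) (hY : CMDiff ∞ (T% Y)) (hZ : CMDiff ∞ (T% Z))
    (x : M) : curvature X Y Z x + curvature Y Z X x + curvature Z X Y x = 0 := by
  rw [← mlieBracket_jacobi_cyclic hX hY hZ x, ← covDeriv_covDeriv_sub_eq_mlieBracket hX hY hZ,
    ← covDeriv_covDeriv_sub_eq_mlieBracket hY hZ hX,
    ← covDeriv_covDeriv_sub_eq_mlieBracket hZ hX hY]
  simp only [curvature_apply]
  abel

theorem tensorialAt_curvature (Y : Π x : M, TangentSpace I x) (hZ : CMDiff ∞ (T% Z)) (x : M) :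
    TensorialAt I E (fun X ↦ curvature X Y Z x) x where
  smul {f X} hf hX := by
    have hXZ : covDeriv (f • X) Z = f • covDeriv X Z :=
      funext fun y ↦ covDeriv_smul_left f X Z y
    have hbracket : covDeriv (mlieBracket I (f • X) Y) Z x =
        f x • covDeriv (mlieBracket I X Y) Z x - dirDeriv Y f x • covDeriv X Z x := by
      rw [covDeriv, mlieBracket_smul_left hf hX, map_add, map_smul, map_smul, dirDeriv, neg_smul,
        neg_add_eq_sub]
      rfl
    rw [curvature_apply, hXZ, covDeriv_smul Y hf (mdiffAt_covDeriv hX hZ), hbracket,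
      covDeriv_smul_left, curvature_apply]
    module
  add {X X'} hX hX' := by
    have hXZ : covDeriv (X + X') Z = covDeriv X Z + covDeriv X' Z :=
      funext fun y ↦ covDeriv_add_left X X' Z y
    have hbracket : covDeriv (mlieBracket I (X + X') Y) Z x =
        covDeriv (mlieBracket I X Y) Z x + covDeriv (mlieBracket I X' Y) Z x := by
      rw [covDeriv, mlieBracket_add_left hX hX', map_add, covDeriv, covDeriv]
    rw [curvature_apply, hXZ, covDeriv_add Y (mdiffAt_covDeriv hX hZ) (mdiffAt_covDeriv hX' hZ),
      hbracket, covDeriv_add_left, curvature_apply, curvature_apply]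
    abel

theorem curvature_congr_left (Y : Π x : M, TangentSpace I x) (hX : CMDiff ∞ (T% X))
    (hX' : CMDiff ∞ (T% X')) (hZ : CMDiff ∞ (T% Z)) (h : X x = X' x) :
    curvature X Y Z x = curvature X' Y Z x :=
  (tensorialAt_curvature Y hZ x).pointwise (mdiffAt_of_contMDiff hX x) (mdiffAt_of_contMDiff hX' x)
    h

-- The Bianchi identity moves the last argument to a slot that is tensorial for formal reasons.
theorem curvature_congr_right (hX : CMDiff ∞ (T% X)) (hY : CMDiff ∞ (T% Y)) (hZ : CMDiff ∞ (T% Z))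
    (hZ' : CMDiff ∞ (T% Z')) (h : Z x = Z' x) : curvature X Y Z x = curvature X Y Z' x := by
  have hB := curvature_bianchi hX hY hZ x
  rw [← curvature_bianchi hX hY hZ' x, curvature_swap Y Z, curvature_swap Y Z',
    curvature_congr_left Y hZ hZ' hX h, curvature_congr_left X hZ hZ' hY h] at hB
  exact add_right_cancel (add_right_cancel hB)

theorem curvature_congr (hX : CMDiff ∞ (T% X)) (hX' : CMDiff ∞ (T% X')) (hY : CMDiff ∞ (T% Y))
    (hY' : CMDiff ∞ (T% Y')) (hZ : CMDiff ∞ (T% Z)) (hZ' : CMDiff ∞ (T% Z'))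
    (hXX' : X x = X' x) (hYY' : Y x = Y' x) (hZZ' : Z x = Z' x) :
    curvature X Y Z x = curvature X' Y' Z' x := by
  rw [curvature_congr_left Y hX hX' hZ hXX', curvature_swap, curvature_congr_left X' hY hY' hZ hYY',
    ← curvature_swap, curvature_congr_right hX' hY' hZ hZ' hZZ']

theorem curvature_congr_of_eventuallyEq (hX : CMDiff ∞ (T% X)) (hY : CMDiff ∞ (T% Y))
    (hZ : CMDiff ∞ (T% Z)) (hXX' : ∀ᶠ y in 𝓝 x, X y = X' y) (hYY' : ∀ᶠ y in 𝓝 x, Y y = Y' y)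
    (hZZ' : ∀ᶠ y in 𝓝 x, Z y = Z' y) : curvature X Y Z x = curvature X' Y' Z' x := by
  have hbracket : mlieBracket I X Y x = mlieBracket I X' Y' x :=
    Filter.EventuallyEq.mlieBracket_vectorField_eq hXX' hYY'
  rw [curvature_apply, curvature_apply, covDeriv_congr (mdiffAt_of_contMDiff hZ x) hZZ' hbracket,
    covDeriv_congr (mdiffAt_of_contMDiff (contMDiff_covDeriv hY hZ) x)
      (eventually_covDeriv_eq hZ hZZ' hYY') hXX'.self_of_nhds,
    covDeriv_congr (mdiffAt_of_contMDiff (contMDiff_covDeriv hX hZ) x)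
      (eventually_covDeriv_eq hZ hZZ' hXX') hYY'.self_of_nhds]

theorem curvatureAt_eq (hX : CMDiff ∞ (T% X)) (hY : CMDiff ∞ (T% Y)) (hZ : CMDiff ∞ (T% Z))
    (x : M) : curvatureAt x (X x) (Y x) (Z x) = curvature X Y Z x := by
  obtain ⟨X', hX', hXX'⟩ := exists_contMDiff_eventuallyEq_extend (X x)
  obtain ⟨Y', hY', hYY'⟩ := exists_contMDiff_eventuallyEq_extend (Y x)
  obtain ⟨Z', hZ', hZZ'⟩ := exists_contMDiff_eventuallyEq_extend (Z x)
  rw [curvatureAt, ← curvature_congr_of_eventuallyEq hX' hY' hZ' hXX' hYY' hZZ']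
  exact curvature_congr hX' hX hY' hY hZ' hZ (by simpa using hXX'.self_of_nhds)
    (by simpa using hYY'.self_of_nhds) (by simpa using hZZ'.self_of_nhds)

theorem curvatureAt_add_left (u u' v w : TangentSpace I x) :
    curvatureAt x (u + u') v w = curvatureAt x u v w + curvatureAt x u' v w := by
  obtain ⟨U, hU, rfl⟩ := exists_contMDiff_eq u
  obtain ⟨U', hU', rfl⟩ := exists_contMDiff_eq u'
  obtain ⟨V, hV, rfl⟩ := exists_contMDiff_eq v
  obtain ⟨W, hW, rfl⟩ := exists_contMDiff_eq w
  rw [curvatureAt_eq hU hV hW, curvatureAt_eq hU' hV hW]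
  exact (curvatureAt_eq (hU.add_section hU') hV hW x).trans
    ((tensorialAt_curvature V hW x).add (mdiffAt_of_contMDiff hU x) (mdiffAt_of_contMDiff hU' x))

theorem curvatureAt_smul_left (c : ℝ) (u v w : TangentSpace I x) :
    curvatureAt x (c • u) v w = c • curvatureAt x u v w := by
  obtain ⟨U, hU, rfl⟩ := exists_contMDiff_eq u
  obtain ⟨V, hV, rfl⟩ := exists_contMDiff_eq v
  obtain ⟨W, hW, rfl⟩ := exists_contMDiff_eq w
  have hc : CMDiff ∞ (fun _ : M ↦ c) := contMDiff_const
  rw [curvatureAt_eq hU hV hW]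
  exact (curvatureAt_eq (hc.smul_section hU) hV hW x).trans
    ((tensorialAt_curvature V hW x).smul (mdiffAt_of_contMDiff hc x) (mdiffAt_of_contMDiff hU x))

theorem inner_curvatureAt_swap (u v w z : TangentSpace I x) :
    inner ℝ (curvatureAt x u v w) z = -inner ℝ (curvatureAt x u v z) w := by
  obtain ⟨U, hU, rfl⟩ := exists_contMDiff_eq u
  obtain ⟨V, hV, rfl⟩ := exists_contMDiff_eq v
  obtain ⟨W, hW, rfl⟩ := exists_contMDiff_eq w
  obtain ⟨Z, hZ, rfl⟩ := exists_contMDiff_eq z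
  rw [curvatureAt_eq hU hV hW, curvatureAt_eq hU hV hZ, inner_curvature_swap hU hV hW hZ]

theorem curvatureAt_bianchi (u v w : TangentSpace I x) :
    curvatureAt x u v w + curvatureAt x v w u + curvatureAt x w u v = 0 := by
  obtain ⟨U, hU, rfl⟩ := exists_contMDiff_eq u
  obtain ⟨V, hV, rfl⟩ := exists_contMDiff_eq v
  obtain ⟨W, hW, rfl⟩ := exists_contMDiff_eq w
  rw [curvatureAt_eq hU hV hW, curvatureAt_eq hV hW hU, curvatureAt_eq hW hU hV,
    curvature_bianchi hU hV hW]

theorem inner_curvatureAt_pair (u v w z : TangentSpace I x) :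
    inner ℝ (curvatureAt x u v w) z = inner ℝ (curvatureAt x w z u) v :=
  pair_symm_of_bianchi (R := fun u v w z ↦ inner ℝ (curvatureAt x u v w) z)
    (fun u v w z ↦ by rw [curvatureAt_swap, inner_neg_left]) inner_curvatureAt_swap
    (fun u v w z ↦ by
      rw [← inner_add_left, ← inner_add_left, curvatureAt_bianchi, inner_zero_left]) u v w z

/-! ### Gradient, Laplacian and Ricci curvature -/

/-- The endomorphism `u ↦ R(u, v)w`, whose trace is the Ricci tensor. -/
def ricciOperator (x : M) (v w : TangentSpace I x) : TangentSpace I x →ₗ[ℝ] TangentSpace I x where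
  toFun u := curvatureAt x u v w
  map_add' u u' := curvatureAt_add_left u u' v w
  map_smul' c u := curvatureAt_smul_left c u v w

theorem ricci_eq_sum {ι : Type*} [Fintype ι] (b : OrthonormalBasis ι ℝ (TangentSpace I x))
    (v w : TangentSpace I x) : ricci x v w = ∑ i, inner ℝ (curvatureAt x (b i) v w) (b i) :=
  metricTrace_eq_sum ((innerₗ _).comp (ricciOperator x v w)) b

theorem ricci_comm (v w : TangentSpace I x) : ricci x v w = ricci x w v := by
  simp only [ricci, metricTrace]
  refine Finset.sum_congr rfl fun i _ ↦ ?_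
  rw [inner_curvatureAt_pair, curvatureAt_swap, inner_neg_left, inner_curvatureAt_swap, neg_neg]

theorem ricci_add_left (v v' w : TangentSpace I x) :
    ricci x (v + v') w = ricci x v w + ricci x v' w := by
  simp only [ricci, metricTrace, ← Finset.sum_add_distrib]
  refine Finset.sum_congr rfl fun i _ ↦ ?_
  rw [curvatureAt_swap, curvatureAt_add_left, curvatureAt_swap _ v, curvatureAt_swap _ v',
    ← inner_add_left, neg_add]

theorem ricci_smul_left (c : ℝ) (v w : TangentSpace I x) :
    ricci x (c • v) w = c * ricci x v w := by
  simp only [ricci, metricTrace, Finset.mul_sum]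
  refine Finset.sum_congr rfl fun i _ ↦ ?_
  rw [curvatureAt_swap, curvatureAt_smul_left, curvatureAt_swap _ v, ← real_inner_smul_left,
    smul_neg]

/-- The Ricci tensor as a bilinear form. -/
def ricciForm (x : M) : TangentSpace I x →ₗ[ℝ] TangentSpace I x →ₗ[ℝ] ℝ :=
  LinearMap.mk₂ ℝ (ricci x) ricci_add_left ricci_smul_left
    (fun v w w' ↦ by rw [ricci_comm, ricci_add_left, ricci_comm w, ricci_comm w'])
    (fun c v w ↦ by rw [ricci_comm, ricci_smul_left, ricci_comm w, smul_eq_mul])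

variable (I) in
/-- The scalar curvature, the metric trace of the Ricci tensor. -/
def scalarCurvature (x : M) : ℝ := metricTrace (ricci (I := I) x)

theorem scalarCurvature_eq_sum {ι : Type*} [Fintype ι]
    (b : OrthonormalBasis ι ℝ (TangentSpace I x)) :
    scalarCurvature I x = ∑ i, ricci x (b i) (b i) :=
  metricTrace_eq_sum (ricciForm x) b

omit [IsContMDiffRiemannianBundle I ∞ E (fun x : M ↦ TangentSpace I x)] in
theorem gradient_eq_of_inner {w : TangentSpace I x}
    (h : ∀ X : Π x : M, TangentSpace I x, CMDiff ∞ (T% X) → dirDeriv X f x = inner ℝ w (X x)) :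
    gradient I f x = w := by
  refine ext_inner_right ℝ fun v ↦ ?_
  obtain ⟨X, hX, rfl⟩ := exists_contMDiff_eq v
  rw [← dirDeriv_eq_inner_gradient, h X hX]

theorem contMDiff_gradient (hf : CMDiff ∞ f) : CMDiff ∞ (T% (gradient I f)) :=
  contMDiff_of_contMDiff_inner fun Z hZ ↦ (contMDiff_dirDeriv hZ hf).congr fun y ↦ by
    rw [dirDeriv_eq_inner_gradient, real_inner_comm]

theorem mdiffAt_gradient (hf : CMDiff ∞ f) (x : M) : MDiffAt (T% (gradient I f)) x :=
  mdiffAt_of_contMDiff (contMDiff_gradient hf) x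

omit [IsContMDiffRiemannianBundle I ∞ E (fun x : M ↦ TangentSpace I x)] in
theorem gradient_add_const_mul (hf : CMDiff ∞ f) (hg : CMDiff ∞ g) (c : ℝ) :
    gradient I (fun y ↦ f y + c * g y) = gradient I f + (fun _ : M ↦ c) • gradient I g := by
  ext1 y
  have hc : MDiffAt (fun _ : M ↦ c) y := mdifferentiableAt_const
  have hg' := mdiffAt_of_contMDiff hg y
  refine gradient_eq_of_inner fun X _ ↦ ?_
  rw [dirDeriv_add (g := fun y ↦ c * g y) X (mdiffAt_of_contMDiff hf y) (hc.mul hg'),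
    dirDeriv_mul X hc hg',
    dirDeriv_const, Pi.add_apply, Pi.smul_apply', inner_add_left, real_inner_smul_left,
    ← dirDeriv_eq_inner_gradient, ← dirDeriv_eq_inner_gradient, mul_zero, add_zero]

omit [IsContMDiffRiemannianBundle I ∞ E (fun x : M ↦ TangentSpace I x)] in
theorem gradient_comp {φ φ' : ℝ → ℝ} (hφ : ∀ t, HasDerivAt φ (φ' t) t) (hf : CMDiff ∞ f) :
    gradient I (fun y ↦ φ (f y)) = (fun y ↦ φ' (f y)) • gradient I f := by
  ext1 y
  refine gradient_eq_of_inner fun X _ ↦ ?_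
  rw [dirDeriv_comp X (hφ (f y)) (mdiffAt_of_contMDiff hf y), Pi.smul_apply', real_inner_smul_left,
    dirDeriv_eq_inner_gradient]

theorem inner_leviCivita_gradient_comm (hf : CMDiff ∞ f) (u v : TangentSpace I x) :
    inner ℝ (leviCivita I M (gradient I f) x u) v =
      inner ℝ (leviCivita I M (gradient I f) x v) u := by
  obtain ⟨X, hX, rfl⟩ := exists_contMDiff_eq u
  obtain ⟨Y, hY, rfl⟩ := exists_contMDiff_eq v
  have hX' := mdiffAt_of_contMDiff hX x
  have hY' := mdiffAt_of_contMDiff hY x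
  have hV := mdiffAt_gradient hf x
  have hgrad (Z : Π x : M, TangentSpace I x) :
      dirDeriv Z f = fun y ↦ inner ℝ (gradient I f y) (Z y) :=
    funext (dirDeriv_eq_inner_gradient Z f)
  have h := dirDeriv_mlieBracket hX hY hf x
  rw [hgrad Y, hgrad X, dirDeriv_inner hX' hV hY', dirDeriv_inner hY' hV hX',
    dirDeriv_eq_inner_gradient, ← covDeriv_sub_covDeriv hX' hY', inner_sub_right] at h
  simp only [covDeriv] at h
  linarith

theorem contMDiff_metricTrace {B : Π x : M, TangentSpace I x →ₗ[ℝ] TangentSpace I x →ₗ[ℝ] ℝ}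
    (hB : ∀ X : Π x : M, TangentSpace I x, CMDiff ∞ (T% X) →
      CMDiff ∞ (fun y : M ↦ B y (X y) (X y))) :
    CMDiff ∞ (fun y : M ↦ metricTrace fun u v ↦ B y u v) := by
  intro x
  obtain ⟨e, he⟩ := exists_isOrthonormalFrameNear (I := I) x
  have h : CMDiff ∞ (fun y : M ↦ ∑ i, B y (e i y) (e i y)) :=
    contMDiff_finsetSum fun i _ ↦ hB (e i) (he.contMDiff i)
  refine (h x).congr_of_eventuallyEq ?_
  filter_upwards [he.eventually_exists_basis] with y ⟨b, hb⟩
  simp only [metricTrace_eq_sum (B y) b, hb]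

theorem contMDiff_divergence (hY : CMDiff ∞ (T% Y)) : CMDiff ∞ (divergence Y) :=
  contMDiff_metricTrace (B := covDerivForm Y) fun _ hX ↦
    contMDiff_inner (contMDiff_covDeriv hX hY) hX

theorem contMDiff_laplacian (hf : CMDiff ∞ f) : CMDiff ∞ (laplacian I f) :=
  (contMDiff_divergence (contMDiff_gradient hf)).neg

theorem laplacian_add_const_mul (hf : CMDiff ∞ f) (hg : CMDiff ∞ g) (c : ℝ) (x : M) :
    laplacian I (fun y ↦ f y + c * g y) x = laplacian I f x + c * laplacian I g x := by
  have hc : MDiffAt (fun _ : M ↦ c) x := mdifferentiableAt_const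
  have hVg := mdiffAt_gradient hg x
  rw [laplacian_eq_neg_divergence, gradient_add_const_mul hf hg,
    divergence_add (mdiffAt_gradient hf x) (hc.smul_section hVg), divergence_const_smul c hVg,
    laplacian_eq_neg_divergence, laplacian_eq_neg_divergence]
  ring

theorem laplacian_comp {φ φ' : ℝ → ℝ} {φ'' : ℝ} (hφ : ∀ t, HasDerivAt φ (φ' t) t)
    (hφ' : HasDerivAt φ' φ'' (f x)) (hf : CMDiff ∞ f) :
    laplacian I (fun y ↦ φ (f y)) x =
      φ' (f x) * laplacian I f x - φ'' * inner ℝ (gradient I f x) (gradient I f x) := by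
  have hfx := mdiffAt_of_contMDiff hf x
  have hφ'f : MDiffAt (fun y ↦ φ' (f y)) x :=
    hφ'.differentiableAt.mdifferentiableAt.comp x hfx
  rw [laplacian_eq_neg_divergence, gradient_comp hφ hf,
    divergence_smul hφ'f (mdiffAt_gradient hf x), ← dirDeriv_eq_inner_gradient,
    dirDeriv_comp _ hφ' hfx, dirDeriv_eq_inner_gradient, laplacian_eq_neg_divergence]
  ring

/-! ### The Bochner formula -/

theorem divergence_covDeriv (hX : CMDiff ∞ (T% X)) (hY : CMDiff ∞ (T% Y)) (x : M) :
    divergence (covDeriv X Y) x = ricci x (X x) (Y x) + dirDeriv X (divergence Y) x +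
      metricTrace fun u v ↦ inner ℝ (leviCivita I M Y x (leviCivita I M X x u)) v := by
  obtain ⟨e, he⟩ := exists_isOrthonormalFrameNear (I := I) x
  obtain ⟨b, hb⟩ := he.eventually_exists_basis.self_of_nhds
  have hX' := mdiffAt_of_contMDiff hX x
  have heY (i) := contMDiff_covDeriv (he.contMDiff i) hY
  have htrace : (metricTrace fun u v ↦ inner ℝ (leviCivita I M Y x (leviCivita I M X x u)) v) =
      ∑ i, inner ℝ (leviCivita I M Y x (covDeriv (e i) X x)) (e i x) := by
    refine (metricTrace_eq_sum ((covDerivForm Y x).comp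
      (leviCivita I M X x : TangentSpace I x →ₗ[ℝ] TangentSpace I x)) b).trans ?_
    simp only [hb]
    rfl
  have hdir : dirDeriv X (divergence Y) x = ∑ i,
      (inner ℝ (covDeriv X (covDeriv (e i) Y) x) (e i x) -
        inner ℝ (leviCivita I M Y x (covDeriv X (e i) x)) (e i x)) := by
    refine (he.dirDeriv_metricTrace (B := covDerivForm Y) hX' fun i ↦
      contMDiff_inner (heY i) (he.contMDiff i)).trans (Finset.sum_congr rfl fun i _ ↦ ?_)
    have h := dirDeriv_inner hX' (mdiffAt_of_contMDiff (heY i) x)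
      (mdiffAt_of_contMDiff (he.contMDiff i) x)
    exact (congrArg (· - _) h).trans (add_sub_add_right_eq_sub _ _ _)
  rw [htrace, hdir, ricci_eq_sum b, divergence_eq_sum b, ← Finset.sum_add_distrib,
    ← Finset.sum_add_distrib]
  refine Finset.sum_congr rfl fun i _ ↦ ?_
  have h := congrArg (fun w ↦ inner ℝ w (e i x)) (covDeriv_covDeriv_comm (he.contMDiff i) hX Y x)
  rw [hb, curvatureAt_eq (he.contMDiff i) hX hY]
  simp only [inner_add_left, inner_sub_left] at h
  change inner ℝ (covDeriv (e i) (covDeriv X Y) x) (e i x) = _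
  linear_combination h

variable (I) in
/-- The function `|∇f|² + f²`, the first integral of the equation `∇²f = -f g`. -/
def energy (f : M → ℝ) (x : M) : ℝ :=
  inner ℝ (gradient I f x) (gradient I f x) + f x * f x

theorem contMDiff_energy (hf : CMDiff ∞ f) : CMDiff ∞ (energy I f) :=
  (contMDiff_inner (contMDiff_gradient hf) (contMDiff_gradient hf)).add (hf.mul hf)

theorem gradient_energy (hf : CMDiff ∞ f) :
    gradient I (energy I f) =
      (fun _ : M ↦ (2 : ℝ)) • (covDeriv (gradient I f) (gradient I f) + f • gradient I f) := by
  ext1 y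
  refine gradient_eq_of_inner fun X hX ↦ ?_
  have hfy := mdiffAt_of_contMDiff hf y
  have hV := mdiffAt_gradient hf y
  have hsymm := inner_leviCivita_gradient_comm hf (X y) (gradient I f y)
  refine (dirDeriv_add (g := fun y ↦ f y * f y) X (mdiffAt_inner hV hV)
    (hfy.mul hfy)).trans ?_
  rw [dirDeriv_inner (mdiffAt_of_contMDiff hX y) hV hV, dirDeriv_mul X hfy hfy,
    dirDeriv_eq_inner_gradient, real_inner_comm (covDeriv X (gradient I f) y), Pi.smul_apply',
    Pi.add_apply, Pi.smul_apply', real_inner_smul_left, inner_add_left, real_inner_smul_left]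
  simp only [covDeriv, hsymm]
  ring

theorem laplacian_energy (hf : CMDiff ∞ f) (x : M) :
    laplacian I (energy I f) x =
      -2 * (ricci x (gradient I f x) (gradient I f x) +
        dirDeriv (gradient I f) (divergence (gradient I f)) x +
        metricTrace (fun u v ↦ inner ℝ (leviCivita I M (gradient I f) x u)
          (leviCivita I M (gradient I f) x v)) +
        f x * divergence (gradient I f) x + inner ℝ (gradient I f x) (gradient I f x)) := by
  have hV := contMDiff_gradient hf
  have hV' := mdiffAt_gradient hf x
  have hfx := mdiffAt_of_contMDiff hf x
  have hVV := mdiffAt_of_contMDiff (contMDiff_covDeriv hV hV) x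
  have hsymm (u : TangentSpace I x) :=
    inner_leviCivita_gradient_comm hf (leviCivita I M (gradient I f) x u) u
  rw [laplacian_eq_neg_divergence, gradient_energy hf,
    divergence_const_smul 2 (mdifferentiableAt_add_section hVV (hfx.smul_section hV')),
    divergence_add hVV (hfx.smul_section hV'), divergence_covDeriv hV hV, divergence_smul hfx hV']
  simp only [metricTrace, hsymm]
  ring

theorem laplacian_energy_of_laplacian_eq (hf : CMDiff ∞ f)
    (hΔ : ∀ y : M, laplacian I f y = (finrank ℝ E : ℝ) * f y) (x : M) :
    laplacian I (energy I f) x =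
      -2 * ((ricci x (gradient I f x) (gradient I f x) -
          ((finrank ℝ E : ℝ) - 1) * inner ℝ (gradient I f x) (gradient I f x)) +
        metricTrace (fun u v ↦ inner ℝ (leviCivita I M (gradient I f) x u + f x • u)
          (leviCivita I M (gradient I f) x v + f x • v))) := by
  have hdiv : divergence (gradient I f) = fun y ↦ -(finrank ℝ E : ℝ) * f y := by
    ext y
    rw [neg_mul, ← hΔ, laplacian_eq_neg_divergence, neg_neg]
  have hdir : dirDeriv (gradient I f) (divergence (gradient I f)) x =
      -(finrank ℝ E : ℝ) * inner ℝ (gradient I f x) (gradient I f x) := by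
    rw [hdiv, dirDeriv_mul _ mdifferentiableAt_const (mdiffAt_of_contMDiff hf x), dirDeriv_const,
      dirDeriv_eq_inner_gradient, mul_zero, add_zero]
  rw [laplacian_energy hf, hdir, metricTrace_leviCivita_add_smul, hdiv]
  ring

/-! ### The strong maximum principle -/

theorem laplacian_nonneg_of_isLocalMax [BoundarylessManifold I M] (hf : CMDiff ∞ f)
    (hmax : IsLocalMax f x) : 0 ≤ laplacian I f x := by
  obtain ⟨e, he⟩ := exists_isOrthonormalFrameNear (I := I) x
  obtain ⟨b, hb⟩ := he.eventually_exists_basis.self_of_nhds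
  rw [laplacian_eq_neg_divergence, divergence_eq_sum b, neg_nonneg]
  refine Finset.sum_nonpos fun i _ ↦ ?_
  have hei := mdiffAt_of_contMDiff (he.contMDiff i) x
  have hleibniz : dirDeriv (e i) (dirDeriv (e i) f) x =
      inner ℝ (covDeriv (e i) (gradient I f) x) (e i x) +
        dirDeriv (covDeriv (e i) (e i)) f x := by
    have hdir : dirDeriv (e i) f = fun y ↦ inner ℝ (gradient I f y) (e i y) :=
      funext fun y ↦ dirDeriv_eq_inner_gradient _ _ _
    rw [hdir, dirDeriv_inner hei (mdiffAt_gradient hf x) hei, dirDeriv_eq_inner_gradient]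
  have hnonpos := dirDeriv_dirDeriv_nonpos_of_isLocalMax hf (he.contMDiff i) hmax
  rw [hleibniz, dirDeriv_eq_zero_of_isLocalMax hf
    (contMDiff_covDeriv (he.contMDiff i) (he.contMDiff i)) hmax, add_zero] at hnonpos
  rw [hb]
  exact hnonpos

omit [IsManifold I ∞ M] [IsContMDiffRiemannianBundle I ∞ E (fun x : M ↦ TangentSpace I x)]
  [T2Space M] in
theorem fderiv_comp_eq_zero_of_gradient_eq_zero {F : Type*} [NormedAddCommGroup F]
    [NormedSpace ℝ F] {k : F → M} {z : F} (hf : MDiffAt f (k z)) (hk : MDiffAt k z)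
    (hgrad : gradient I f (k z) = 0) : fderiv ℝ (f ∘ k) z = 0 := by
  have hdf : d% f (k z) = 0 :=
    (InnerProductSpace.toDual ℝ _).symm.injective (hgrad.trans (map_zero _).symm)
  have hzero : HasFDerivAt (f ∘ k) (0 : F →L[ℝ] ℝ) z :=
    (hf.hasMFDerivAt.comp z hk.hasMFDerivAt).hasFDerivAt.congr_fderiv
      (ContinuousLinearMap.ext fun v ↦ DFunLike.congr_fun hdf (mfderiv% k z v))
  exact hzero.fderiv

omit [IsContMDiffRiemannianBundle I ∞ E (fun x : M ↦ TangentSpace I x)] in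
theorem exists_contMDiff_gradient_ne_zero_lt [I.Boundaryless] {K : Set M} (hK : IsClosed K)
    {a : M} (ha : a ∈ K) (hint : a ∉ interior K) :
    ∃ x ∈ K, ∃ ρ : M → ℝ, CMDiff ∞ ρ ∧ gradient I ρ x ≠ 0 ∧
      ∀ᶠ y in 𝓝 x, y ∈ K → y ≠ x → ρ x < ρ y := by
  obtain ⟨Φ, haΦ, hΦ, hΦsymm⟩ := exists_openPartialHomeomorph_contMDiffOn (I := I) a
  obtain ⟨r, hr, hball⟩ := Metric.nhds_basis_closedBall.mem_iff.1
    (Φ.open_target.mem_nhds (Φ.map_source haΦ))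
  let C := Metric.closedBall (Φ a) r ∩ Φ.symm ⁻¹' K
  have hC : IsClosed C := (hΦsymm.continuousOn.mono hball).preimage_isClosed_of_isClosed
    Metric.isClosed_closedBall hK
  have haC : Φ a ∈ C := ⟨Metric.mem_closedBall_self hr.le, by simpa [Φ.left_inv haΦ] using ha⟩
  have hintC : Φ a ∉ interior C := fun h ↦ hint <| mem_interior_iff_mem_nhds.2 <| by
    filter_upwards [Φ.open_source.mem_nhds haΦ,
      (Φ.continuousAt haΦ).preimage_mem_nhds (mem_interior_iff_mem_nhds.1 h)] with y hyΦ hy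
    simpa [Φ.left_inv hyΦ] using hy.2
  obtain ⟨z, hzC, hza, φ, hφ, hφz, hφlt⟩ := exists_contDiff_fderiv_ne_zero_lt hC haC hintC hr
  have hzΦ : z ∈ Φ.target := hball hzC.1
  have hxΦ : Φ.symm z ∈ Φ.source := Φ.map_target hzΦ
  obtain ⟨ρ, hρ, hρφ⟩ := exists_contMDiff_eventuallyEq_of_contMDiffOn Φ.open_source hxΦ
    (hφ.contMDiff.comp_contMDiffOn hΦ)
  refine ⟨Φ.symm z, hzC.2, ρ, hρ, fun hgrad ↦ hφz ?_, ?_⟩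
  · have hΦz := ((hΦsymm z hzΦ).contMDiffAt (Φ.open_target.mem_nhds hzΦ)).mdifferentiableAt
      (by simp : (∞ : WithTop ℕ∞) ≠ 0)
    have hφρ : φ =ᶠ[𝓝 z] ρ ∘ Φ.symm := by
      filter_upwards [(Φ.symm.continuousAt hzΦ).eventually hρφ, Φ.open_target.mem_nhds hzΦ]
        with p hp hpΦ
      rw [Function.comp_apply, hp, Function.comp_apply, Φ.right_inv hpΦ]
    rw [hφρ.fderiv_eq]
    exact fderiv_comp_eq_zero_of_gradient_eq_zero (mdiffAt_of_contMDiff hρ _) hΦz hgrad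
  · have hxball : Φ (Φ.symm z) ∈ Metric.ball (Φ a) r := by rwa [Φ.right_inv hzΦ]
    filter_upwards [(Φ.continuousAt hxΦ).eventually (Metric.isOpen_ball.mem_nhds hxball),
      Φ.open_source.mem_nhds hxΦ, hρφ] with y hyball hyΦ hy hyK hyne
    rw [hρφ.self_of_nhds, hy, Function.comp_apply, Function.comp_apply, Φ.right_inv hzΦ]
    refine hφlt _ ⟨Metric.ball_subset_closedBall hyball, ?_⟩ fun h ↦ hyne ?_
    · simpa [Φ.left_inv hyΦ] using hyK
    · rw [← h, Φ.left_inv hyΦ]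

theorem exists_laplacian_exp_neg_mul_neg (hf : CMDiff ∞ f) (hgrad : gradient I f x ≠ 0) :
    ∃ α : ℝ, 0 < α ∧ laplacian I (fun y ↦ Real.exp (-α * f y)) x < 0 := by
  have hpos : 0 < inner ℝ (gradient I f x) (gradient I f x) := real_inner_self_pos.2 hgrad
  refine ⟨(|laplacian I f x| + 1) / inner ℝ (gradient I f x) (gradient I f x), by positivity, ?_⟩
  set α := (|laplacian I f x| + 1) / inner ℝ (gradient I f x) (gradient I f x)
  have hexp (t : ℝ) : HasDerivAt (fun s ↦ Real.exp (-α * s)) (-α * Real.exp (-α * t)) t := by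
    simpa [mul_comm] using ((hasDerivAt_id t).const_mul (-α)).exp
  rw [laplacian_comp hexp ((hexp _).const_mul (-α)) hf]
  have hαinner : α * inner ℝ (gradient I f x) (gradient I f x) = |laplacian I f x| + 1 :=
    div_mul_cancel₀ _ hpos.ne'
  have hαpos : 0 < α := by positivity
  have hfactor : 0 < α * Real.exp (-α * f x) *
      (laplacian I f x + α * inner ℝ (gradient I f x) (gradient I f x)) :=
    mul_pos (mul_pos hαpos (Real.exp_pos _)) (by linarith [neg_abs_le (laplacian I f x)])
  linarith

theorem exists_pos_forall_add_mul_lt {T : Type*} [TopologicalSpace T] {S : Set T}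
    (hS : IsCompact S) {u w : T → ℝ} (hu : Continuous u) (hw : Continuous w) {m : ℝ}
    (hum : ∀ q, u q ≤ m) (hneg : ∀ q ∈ S, u q = m → w q < 0) :
    ∃ ε > 0, ∀ q ∈ S, u q + ε * w q < m := by
  have hev : ∀ᶠ ε in 𝓝 (0 : ℝ), ∀ q ∈ S, 0 < ε → u q + ε * w q < m := by
    refine hS.eventually_forall_of_forall_eventually fun q hq ↦ ?_
    rcases (hum q).lt_or_eq with hlt | heq
    · have hcont : Continuous fun z : ℝ × T ↦ u z.2 + z.1 * w z.2 := by fun_prop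
      exact (hcont.continuousAt.eventually_lt continuousAt_const (by simpa using hlt)).mono
        fun z hz _ ↦ hz
    · have hcont : Continuous fun z : ℝ × T ↦ w z.2 := by fun_prop
      filter_upwards [hcont.continuousAt.eventually_lt continuousAt_const (hneg q hq heq)]
        with z hz hpos
      linarith [hum z.2, mul_neg_of_pos_of_neg hpos hz]
  obtain ⟨ε, hε, hεpos⟩ := ((hev.filter_mono nhdsWithin_le_nhds).and self_mem_nhdsWithin).exists
    (f := 𝓝[>] (0 : ℝ))
  exact ⟨ε, hεpos, fun q hq ↦ hε q hq hεpos⟩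

variable {u v : M → ℝ}

-- Otherwise `u + εv`, for a small `ε > 0`, has a local maximum where its Laplacian is negative.
theorem not_eventually_lt_of_laplacian_neg [BoundarylessManifold I M] (hu : CMDiff ∞ u)
    (hv : CMDiff ∞ v) (hΔu : ∀ y : M, laplacian I u y ≤ 0) (hmax : ∀ y, u y ≤ u x)
    (hΔv : laplacian I v x < 0) : ¬ ∀ᶠ y in 𝓝 x, u y = u x → y ≠ x → v y < v x := by
  intro hlt
  have : LocallyCompactSpace M := Manifold.locallyCompact_of_finiteDimensional I
  obtain ⟨B, hxB, hB, hBc⟩ := LocallyCompactSpace.local_compact_nhds x _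
    (((contMDiff_laplacian hv).continuous.continuousAt.eventually_lt continuousAt_const hΔv).and
      hlt)
  have hfrontier : ∀ y ∈ frontier B, u y = u x → v y - v x < 0 := fun y hy huy ↦
    sub_neg.2 <| (hB (hBc.isClosed.frontier_subset hy)).2 huy <| by
      rintro rfl
      exact hy.2 (mem_interior_iff_mem_nhds.2 hxB)
  obtain ⟨ε, hε, hεB⟩ := exists_pos_forall_add_mul_lt (w := fun y ↦ v y - v x)
    (hBc.of_isClosed_subset isClosed_frontier hBc.isClosed.frontier_subset) hu.continuous
    (hv.continuous.sub continuous_const) hmax hfrontier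
  have hw : CMDiff ∞ (fun y ↦ u y + ε * v y) := hu.add (contMDiff_const.mul hv)
  obtain ⟨p, hpB, hp⟩ := hBc.exists_isMaxOn ⟨x, mem_of_mem_nhds hxB⟩ hw.continuous.continuousOn
  have hpint : p ∈ interior B := by
    by_contra hpint
    have hxp : u x + ε * v x ≤ u p + ε * v p := hp (mem_of_mem_nhds hxB)
    linarith [hεB p ⟨subset_closure hpB, hpint⟩]
  have hlocal : IsLocalMax (fun y ↦ u y + ε * v y) p := by
    filter_upwards [mem_interior_iff_mem_nhds.1 hpint] with q hq using hp hq
  have hnonneg := laplacian_nonneg_of_isLocalMax hw hlocal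
  rw [laplacian_add_const_mul hu hv] at hnonneg
  linarith [hΔu p, mul_neg_of_pos_of_neg hε (hB hpB).1]

theorem eq_of_laplacian_nonpos [I.Boundaryless] [CompactSpace M] [PreconnectedSpace M]
    (hu : CMDiff ∞ u) (hΔ : ∀ y : M, laplacian I u y ≤ 0) (y z : M) : u y = u z := by
  obtain ⟨m, -, hm⟩ := isCompact_univ.exists_isMaxOn ⟨y, mem_univ y⟩ hu.continuous.continuousOn
  have hmax : ∀ q, u q ≤ u m := fun q ↦ hm (mem_univ q)
  let K : Set M := {q | u q = u m}
  have hK : IsClosed K := isClosed_eq hu.continuous continuous_const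
  suffices hKopen : IsOpen K by
    have hKuniv : K = univ := IsClopen.eq_univ ⟨hK, hKopen⟩ ⟨m, rfl⟩
    exact (hKuniv ▸ mem_univ y : y ∈ K).trans (hKuniv ▸ mem_univ z : z ∈ K).symm
  refine subset_interior_iff_isOpen.1 fun a haK ↦ by_contra fun haint ↦ ?_
  obtain ⟨x, hxK, ρ, hρ, hgrad, hlt⟩ :=
    exists_contMDiff_gradient_ne_zero_lt (I := I) hK haK haint
  obtain ⟨α, hα, hΔexp⟩ := exists_laplacian_exp_neg_mul_neg hρ hgrad
  have hxm : u x = u m := hxK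
  have hexp : CMDiff ∞ (fun y ↦ Real.exp (-α * ρ y)) :=
    Real.contDiff_exp.contMDiff.comp (contMDiff_const.mul hρ)
  refine not_eventually_lt_of_laplacian_neg hu hexp hΔ (hxm ▸ hmax) hΔexp ?_
  filter_upwards [hlt] with q hq hqx hne
  exact Real.exp_lt_exp.2 (by nlinarith [hq (hqx.trans hxm) hne])

/-! ### The Obata equation -/

variable (I) in
/-- Smooth solutions of Obata's equation `∇²f = -f g`, which is expressed through the endomorphism
`v ↦ ∇_v ∇f`. -/
structure IsObataFunction (f : M → ℝ) : Prop where
  contMDiff : CMDiff ∞ f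
  leviCivita_gradient (x : M) (v : TangentSpace I x) :
    leviCivita I M (gradient I f) x v = -(f x • v)

section Bochner

variable (hRic : ∀ (x : M) (v : TangentSpace I x),
  ((finrank ℝ E : ℝ) - 1) * inner ℝ v v ≤ ricci x v v) (hf : CMDiff ∞ f)
  (hΔ : ∀ y : M, laplacian I f y = (finrank ℝ E : ℝ) * f y)

include hRic hf hΔ

theorem laplacian_energy_nonpos (x : M) : laplacian I (energy I f) x ≤ 0 := by
  have hnonneg : 0 ≤ metricTrace fun u v ↦ inner ℝ (leviCivita I M (gradient I f) x u + f x • u)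
      (leviCivita I M (gradient I f) x v + f x • v) :=
    Finset.sum_nonneg fun i _ ↦ real_inner_self_nonneg
  rw [laplacian_energy_of_laplacian_eq hf hΔ]
  linarith [hRic x (gradient I f x)]

variable [I.Boundaryless] [CompactSpace M] [PreconnectedSpace M]

theorem energy_eq (x y : M) : energy I f x = energy I f y :=
  eq_of_laplacian_nonpos (contMDiff_energy hf) (laplacian_energy_nonpos hRic hf hΔ) x y

theorem isObataFunction : IsObataFunction I f where
  contMDiff := hf
  leviCivita_gradient x v := by
    have hmax : IsLocalMax (energy I f) x :=
      Eventually.of_forall fun y ↦ (energy_eq hRic hf hΔ y x).le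
    have hlaplacian := laplacian_nonneg_of_isLocalMax (contMDiff_energy hf) hmax
    rw [laplacian_energy_of_laplacian_eq hf hΔ] at hlaplacian
    have hzero : (leviCivita I M (gradient I f) x : TangentSpace I x →ₗ[ℝ] TangentSpace I x) +
        f x • .id = 0 :=
      eq_zero_of_sum_inner_self_nonpos (stdOrthonormalBasis ℝ (TangentSpace I x)) <| by
        change metricTrace (fun u v ↦ inner ℝ (leviCivita I M (gradient I f) x u + f x • u)
          (leviCivita I M (gradient I f) x v + f x • v)) ≤ 0
        linarith [hRic x (gradient I f x)]
    exact eq_neg_of_add_eq_zero_left (DFunLike.congr_fun hzero v)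

end Bochner

theorem IsObataFunction.frequently_gradient_ne_zero [Nontrivial E] (hf : IsObataFunction I f)
    (hx : energy I f x ≠ 0) : ∃ᶠ y in 𝓝 x, gradient I f y ≠ 0 := by
  intro hev
  have hgrad : ∀ᶠ y in 𝓝 x, gradient I f y = 0 := hev.mono fun y ↦ not_not.1
  have : Nontrivial (TangentSpace I x) := inferInstanceAs (Nontrivial E)
  obtain ⟨v, hv⟩ := exists_ne (0 : TangentSpace I x)
  have hcov : leviCivita I M (gradient I f) x = 0 :=
    ((leviCivita I M).isCovariantDerivativeOnUniv.congr_of_eventuallyEq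
      (mdiffAt_gradient hf.contMDiff x) (mdifferentiable_zeroSection ℝ _ x) univ_mem hgrad).trans
        (congrFun (leviCivita I M).zero x)
  have hfx : f x = 0 := by
    have hHess := hf.leviCivita_gradient x v
    rw [hcov, zero_apply, zero_eq_neg] at hHess
    exact (smul_eq_zero.1 hHess).resolve_right hv
  refine hx ?_
  rw [energy, hgrad.self_of_nhds, inner_zero_left, hfx, mul_zero, add_zero]

/-! ### The second Bianchi identity -/

/-- The covariant derivative `(∇_W R)(X, Y)Z` of the curvature tensor. -/
def curvatureDeriv (W X Y Z : Π x : M, TangentSpace I x) (x : M) : TangentSpace I x :=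
  covDeriv W (curvature X Y Z) x - curvature (covDeriv W X) Y Z x -
    curvature X (covDeriv W Y) Z x - curvature X Y (covDeriv W Z) x

theorem curvatureDeriv_swap (W : Π x : M, TangentSpace I x) (hX : CMDiff ∞ (T% X))
    (hY : CMDiff ∞ (T% Y)) (hZ : CMDiff ∞ (T% Z)) (x : M) :
    curvatureDeriv W X Y Z x = -curvatureDeriv W Y X Z x := by
  have hswap : curvature X Y Z = -curvature Y X Z := funext fun y ↦ curvature_swap X Y Z y
  rw [curvatureDeriv, curvatureDeriv, hswap,
    covDeriv_neg W (mdiffAt_of_contMDiff (contMDiff_curvature hY hX hZ) x),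
    curvature_swap (covDeriv W X), curvature_swap X, curvature_swap X Y]
  abel

theorem curvature_mlieBracket_left (hX : CMDiff ∞ (T% X)) (hY : CMDiff ∞ (T% Y))
    (hZ : CMDiff ∞ (T% Z)) (hW : CMDiff ∞ (T% W)) (x : M) :
    curvature (mlieBracket I X Y) W Z x =
      curvature (covDeriv X Y) W Z x - curvature (covDeriv Y X) W Z x := by
  rw [← curvatureAt_eq (contMDiff_mlieBracket hX hY) hW hZ,
    ← covDeriv_sub_covDeriv (mdiffAt_of_contMDiff hX x) (mdiffAt_of_contMDiff hY x),
    ← curvatureAt_eq (contMDiff_covDeriv hX hY) hW hZ,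
    ← curvatureAt_eq (contMDiff_covDeriv hY hX) hW hZ]
  exact map_sub (ricciOperator x (W x) (Z x)) _ _

theorem covDeriv_curvature (W : Π x : M, TangentSpace I x) (hX : CMDiff ∞ (T% X))
    (hY : CMDiff ∞ (T% Y)) (hZ : CMDiff ∞ (T% Z)) (x : M) :
    covDeriv W (curvature X Y Z) x =
      covDeriv W (covDeriv X (covDeriv Y Z)) x - covDeriv W (covDeriv Y (covDeriv X Z)) x -
        covDeriv W (covDeriv (mlieBracket I X Y) Z) x := by
  have hXY := contMDiff_covDeriv hX (contMDiff_covDeriv hY hZ)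
  have hYX := contMDiff_covDeriv hY (contMDiff_covDeriv hX hZ)
  have hbracket := contMDiff_covDeriv (contMDiff_mlieBracket hX hY) hZ
  rw [← covDeriv_sub W (mdiffAt_of_contMDiff hXY x) (mdiffAt_of_contMDiff hYX x),
    ← covDeriv_sub W (mdiffAt_of_contMDiff (hXY.sub_section hYX) x)
      (mdiffAt_of_contMDiff hbracket x)]
  rfl

-- The Jacobi identity, for the operators `∇_W`, `∇_X`, `∇_Y` and for the fields `W`, `X`, `Y`.
theorem covDeriv_curvature_cyclic (hW : CMDiff ∞ (T% W)) (hX : CMDiff ∞ (T% X))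
    (hY : CMDiff ∞ (T% Y)) (hZ : CMDiff ∞ (T% Z)) (x : M) :
    (covDeriv W (curvature X Y Z) x - curvature X Y (covDeriv W Z) x -
        curvature (mlieBracket I X Y) W Z x) +
      (covDeriv X (curvature Y W Z) x - curvature Y W (covDeriv X Z) x -
        curvature (mlieBracket I Y W) X Z x) +
      (covDeriv Y (curvature W X Z) x - curvature W X (covDeriv Y Z) x -
        curvature (mlieBracket I W X) Y Z x) = 0 := by
  have hJacobi : covDeriv (mlieBracket I (mlieBracket I X Y) W) Z x +
      covDeriv (mlieBracket I (mlieBracket I Y W) X) Z x +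
      covDeriv (mlieBracket I (mlieBracket I W X) Y) Z x = 0 := by
    simp only [covDeriv, ← map_add]
    rw [mlieBracket_swap_apply (W := W), mlieBracket_swap_apply (W := X),
      mlieBracket_swap_apply (W := Y), ← neg_add, ← neg_add,
      mlieBracket_jacobi_cyclic hW hX hY, neg_zero, map_zero]
  rw [covDeriv_curvature W hX hY hZ, covDeriv_curvature X hY hW hZ,
    covDeriv_curvature Y hW hX hZ, ← hJacobi]
  simp only [curvature_apply]
  abel

theorem curvatureDeriv_bianchi (hW : CMDiff ∞ (T% W)) (hX : CMDiff ∞ (T% X))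
    (hY : CMDiff ∞ (T% Y)) (hZ : CMDiff ∞ (T% Z)) (x : M) :
    curvatureDeriv W X Y Z x + curvatureDeriv X Y W Z x + curvatureDeriv Y W X Z x = 0 := by
  rw [← covDeriv_curvature_cyclic hW hX hY hZ x, curvature_mlieBracket_left hX hY hZ hW,
    curvature_mlieBracket_left hY hW hZ hX, curvature_mlieBracket_left hW hX hZ hY]
  rw [curvatureDeriv, curvatureDeriv, curvatureDeriv, curvature_swap X (covDeriv W Y),
    curvature_swap Y (covDeriv X W), curvature_swap W (covDeriv Y X)]
  abel

namespace IsObataFunction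

omit [T2Space M] in
theorem curvature_gradient (hf : IsObataFunction I f) (hX : CMDiff ∞ (T% X))
    (hY : CMDiff ∞ (T% Y)) (x : M) :
    curvature X Y (gradient I f) x =
      (inner ℝ (gradient I f x) (Y x) : ℝ) • X x - (inner ℝ (gradient I f x) (X x) : ℝ) • Y x := by
  have hcov (A : Π x : M, TangentSpace I x) : covDeriv A (gradient I f) = -(f • A) :=
    funext fun y ↦ hf.leviCivita_gradient y (A y)
  have hf' := mdiffAt_of_contMDiff hf.contMDiff x
  have hX' := mdiffAt_of_contMDiff hX x
  have hY' := mdiffAt_of_contMDiff hY x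
  rw [curvature_apply, hcov, hcov, hcov, covDeriv_neg X (hf'.smul_section hY'),
    covDeriv_neg Y (hf'.smul_section hX'), covDeriv_smul X hf' hY', covDeriv_smul Y hf' hX',
    Pi.neg_apply, Pi.smul_apply', ← covDeriv_sub_covDeriv hX' hY', dirDeriv_eq_inner_gradient,
    dirDeriv_eq_inner_gradient]
  module

theorem curvature_gradient_left (hf : IsObataFunction I f) (hX : CMDiff ∞ (T% X))
    (hY : CMDiff ∞ (T% Y)) (x : M) : curvature (gradient I f) X Y x =
      (inner ℝ (X x) (Y x) : ℝ) • gradient I f x - (inner ℝ (gradient I f x) (Y x) : ℝ) • X x := by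
  refine ext_inner_right ℝ fun w ↦ ?_
  obtain ⟨W, hW, rfl⟩ := exists_contMDiff_eq w
  have hV := contMDiff_gradient hf.contMDiff
  rw [← curvatureAt_eq hV hX hY, inner_curvatureAt_pair, curvatureAt_eq hY hW hV,
    hf.curvature_gradient hY hW]
  simp only [inner_sub_left, real_inner_smul_left]
  rw [real_inner_comm (X x) (Y x), real_inner_comm (X x) (W x)]
  ring

theorem curvatureDeriv_gradient_left (hf : IsObataFunction I f) (hW : CMDiff ∞ (T% W))
    (hX : CMDiff ∞ (T% X)) (hY : CMDiff ∞ (T% Y)) (x : M) :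
    curvatureDeriv W (gradient I f) X Y x = f x • (curvature W X Y x -
      ((inner ℝ (X x) (Y x) : ℝ) • W x - (inner ℝ (W x) (Y x) : ℝ) • X x)) := by
  have hV := contMDiff_gradient hf.contMDiff
  have hW' := mdiffAt_of_contMDiff hW x
  have hX' := mdiffAt_of_contMDiff hX x
  have hY' := mdiffAt_of_contMDiff hY x
  have hV' := mdiffAt_of_contMDiff hV x
  have hXY := mdiffAt_inner hX' hY'
  have hVY := mdiffAt_inner hV' hY'
  have hcurvature : curvature (gradient I f) X Y =
      (fun y : M ↦ (inner ℝ (X y) (Y y) : ℝ)) • gradient I f -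
        (fun y : M ↦ (inner ℝ (gradient I f y) (Y y) : ℝ)) • X :=
    funext fun y ↦ hf.curvature_gradient_left hX hY y
  have hcovV : covDeriv W (gradient I f) x = -(f x • W x) := hf.leviCivita_gradient x (W x)
  have hcovVX : curvature (covDeriv W (gradient I f)) X Y x = -(f x • curvature W X Y x) := by
    rw [← curvatureAt_eq (contMDiff_covDeriv hW hV) hX hY, hcovV, ← neg_smul,
      curvatureAt_smul_left, curvatureAt_eq hW hX hY, neg_smul]
  rw [curvatureDeriv, hcovVX, hf.curvature_gradient_left (contMDiff_covDeriv hW hX) hY,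
    hf.curvature_gradient_left hX (contMDiff_covDeriv hW hY), hcurvature,
    covDeriv_sub W (hXY.smul_section hV') (hVY.smul_section hX'), covDeriv_smul W hXY hV',
    covDeriv_smul W hVY hX', dirDeriv_inner hW' hX' hY', dirDeriv_inner hW' hV' hY', hcovV,
    inner_neg_left, real_inner_smul_left]
  module

theorem curvatureDeriv_gradient (hf : IsObataFunction I f) (hX : CMDiff ∞ (T% X))
    (hY : CMDiff ∞ (T% Y)) (hZ : CMDiff ∞ (T% Z)) (x : M) :
    curvatureDeriv (gradient I f) X Y Z x = (2 * f x) • (curvature X Y Z x -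
      ((inner ℝ (Y x) (Z x) : ℝ) • X x - (inner ℝ (X x) (Z x) : ℝ) • Y x)) := by
  have hV := contMDiff_gradient hf.contMDiff
  have hBianchi := curvatureDeriv_bianchi hV hX hY hZ x
  rw [curvatureDeriv_swap X hY hV hZ, hf.curvatureDeriv_gradient_left hX hY hZ,
    hf.curvatureDeriv_gradient_left hY hX hZ, curvature_swap Y X] at hBianchi
  rw [← sub_eq_zero, ← hBianchi]
  module

end IsObataFunction

/-! ### Scalar curvature -/

theorem contMDiff_ricci (hY : CMDiff ∞ (T% Y)) (hZ : CMDiff ∞ (T% Z)) :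
    CMDiff ∞ (fun y : M ↦ ricci y (Y y) (Z y)) :=
  contMDiff_metricTrace (B := fun y ↦ (innerₗ _).comp (ricciOperator y (Y y) (Z y))) fun X hX ↦
    (contMDiff_inner (contMDiff_curvature hX hY hZ) hX).congr fun y ↦
      congrArg (fun u ↦ inner ℝ u (X y)) (curvatureAt_eq hX hY hZ y)

theorem contMDiff_scalarCurvature : CMDiff ∞ (scalarCurvature I : M → ℝ) :=
  contMDiff_metricTrace (B := ricciForm) fun _ hX ↦ contMDiff_ricci hX hX

section

variable {e : Fin (finrank ℝ E) → Π x : M, TangentSpace I x}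

theorem IsOrthonormalFrameNear.dirDeriv_ricci (he : IsOrthonormalFrameNear e x)
    (hX : CMDiff ∞ (T% X)) (hY : CMDiff ∞ (T% Y)) (hZ : CMDiff ∞ (T% Z)) :
    dirDeriv X (fun y ↦ ricci y (Y y) (Z y)) x =
      ∑ j, inner ℝ (curvatureDeriv X (e j) Y Z x) (e j x) +
        (ricci x (covDeriv X Y x) (Z x) + ricci x (Y x) (covDeriv X Z x)) := by
  obtain ⟨b, hb⟩ := he.eventually_exists_basis.self_of_nhds
  have hX' := mdiffAt_of_contMDiff hX x
  have hR (j) := contMDiff_curvature (he.contMDiff j) hY hZ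
  have hoperator (j) (y : M) :
      ricciOperator y (Y y) (Z y) (e j y) = curvature (e j) Y Z y :=
    curvatureAt_eq (he.contMDiff j) hY hZ y
  have htrace := he.dirDeriv_metricTrace hX'
    (B := fun y ↦ (innerₗ _).comp (ricciOperator y (Y y) (Z y))) fun j ↦
      (contMDiff_inner (hR j) (he.contMDiff j)).congr fun y ↦
        congrArg (fun u ↦ inner ℝ u (e j y)) (hoperator j y)
  refine htrace.trans ?_
  rw [ricci_eq_sum b, ricci_eq_sum b, ← Finset.sum_add_distrib, ← Finset.sum_add_distrib]
  refine Finset.sum_congr rfl fun j _ ↦ ?_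
  have hXe := contMDiff_covDeriv hX (he.contMDiff j)
  simp only [LinearMap.comp_apply, innerₗ_apply_apply, hoperator, hb]
  rw [dirDeriv_inner hX' (mdiffAt_of_contMDiff (hR j) x) (mdiffAt_of_contMDiff (he.contMDiff j) x),
    curvatureAt_eq (he.contMDiff j) (contMDiff_covDeriv hX hY) hZ,
    curvatureAt_eq (he.contMDiff j) hY (contMDiff_covDeriv hX hZ), curvatureDeriv,
    show ricciOperator x (Y x) (Z x) (covDeriv X (e j) x) = curvature (covDeriv X (e j)) Y Z x from
      curvatureAt_eq hXe hY hZ x]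
  simp only [inner_sub_left]
  ring

theorem IsOrthonormalFrameNear.dirDeriv_scalarCurvature (he : IsOrthonormalFrameNear e x)
    (hX : CMDiff ∞ (T% X)) :
    dirDeriv X (scalarCurvature I) x =
      ∑ i, ∑ j, inner ℝ (curvatureDeriv X (e j) (e i) (e i) x) (e j x) := by
  refine (he.dirDeriv_metricTrace (B := ricciForm) (mdiffAt_of_contMDiff hX x) fun i ↦
    contMDiff_ricci (he.contMDiff i) (he.contMDiff i)).trans (Finset.sum_congr rfl fun i _ ↦ ?_)
  exact sub_eq_iff_eq_add.2 (he.dirDeriv_ricci hX (he.contMDiff i) (he.contMDiff i))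

end

theorem IsObataFunction.dirDeriv_gradient_scalarCurvature (hf : IsObataFunction I f) (x : M) :
    dirDeriv (gradient I f) (scalarCurvature I) x =
      2 * f x * (scalarCurvature I x - (finrank ℝ E : ℝ) * ((finrank ℝ E : ℝ) - 1)) := by
  obtain ⟨e, he⟩ := exists_isOrthonormalFrameNear (I := I) x
  obtain ⟨b, hb⟩ := he.eventually_exists_basis.self_of_nhds
  have hterm (i j) :
      inner ℝ (curvatureDeriv (gradient I f) (e j) (e i) (e i) x) (e j x) =
        2 * f x * (inner ℝ (curvatureAt x (b j) (b i) (b i)) (b j) -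
          (1 - if i = j then 1 else 0)) := by
    rw [hf.curvatureDeriv_gradient (he.contMDiff j) (he.contMDiff i) (he.contMDiff i),
      ← curvatureAt_eq (he.contMDiff j) (he.contMDiff i) (he.contMDiff i)]
    simp only [← hb, inner_sub_left, real_inner_smul_left, b.inner_eq_ite, if_true,
      eq_comm (a := j)]
    split_ifs <;> ring
  rw [he.dirDeriv_scalarCurvature (contMDiff_gradient hf.contMDiff), scalarCurvature_eq_sum b]
  simp only [hterm, ← Finset.mul_sum, Finset.sum_sub_distrib, ← ricci_eq_sum b, Finset.sum_ite_eq,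
    Finset.mem_univ, if_true, Finset.sum_const, Finset.card_univ, Fintype.card_fin, nsmul_eq_mul]
  ring

theorem nonpos_of_dirDeriv_gradient_eq_zero [BoundarylessManifold I M] [CompactSpace M]
    (hf : CMDiff ∞ f) (hg : CMDiff ∞ g) (hdir : ∀ y, dirDeriv (gradient I f) g y = 0)
    (hcrit : ∀ y, gradient I f y = 0 → g y = 0) (x : M) : g x ≤ 0 := by
  have hexp : CMDiff ∞ (fun y ↦ Real.exp (f y)) := Real.contDiff_exp.contMDiff.comp hf
  obtain ⟨p, -, hp⟩ := isCompact_univ.exists_isMaxOn ⟨x, mem_univ x⟩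
    (hg.mul hexp).continuous.continuousOn
  have hgp : g p = 0 := by
    have hmax : IsLocalMax (fun y ↦ g y * Real.exp (f y)) p := hp.isLocalMax univ_mem
    -- At `p`, `0 = ∇f(g e^f) = g |∇f|² e^f`.
    have hzero := dirDeriv_eq_zero_of_isLocalMax (hg.mul hexp) (contMDiff_gradient hf) hmax
    change dirDeriv (gradient I f) (fun y ↦ g y * Real.exp (f y)) p = 0 at hzero
    rw [dirDeriv_mul _ (mdiffAt_of_contMDiff hg p) (mdiffAt_of_contMDiff hexp p), hdir, mul_zero,
      add_zero, dirDeriv_comp _ (Real.hasDerivAt_exp (f p)) (mdiffAt_of_contMDiff hf p),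
      dirDeriv_eq_inner_gradient, mul_eq_zero, mul_eq_zero, inner_self_eq_zero] at hzero
    exact hzero.elim id fun h ↦ h.elim (fun h ↦ absurd h (Real.exp_ne_zero _)) (hcrit p)
  have hle : g x * Real.exp (f x) ≤ g p * Real.exp (f p) := hp (mem_univ x)
  rw [hgp, zero_mul] at hle
  exact nonpos_of_mul_nonpos_left hle (Real.exp_pos _)

namespace IsObataFunction

theorem dirDeriv_scalarCurvature_sub_mul_gradient_sq (hf : IsObataFunction I f) (x : M) :
    dirDeriv (gradient I f) (fun y ↦
      (scalarCurvature I y - (finrank ℝ E : ℝ) * ((finrank ℝ E : ℝ) - 1)) *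
        (inner ℝ (gradient I f y) (gradient I f y) : ℝ)) x = 0 := by
  have hscalar := mdiffAt_of_contMDiff (contMDiff_scalarCurvature (I := I)) x
  have hexcess : MDiffAt (fun y : M ↦
      scalarCurvature I y - (finrank ℝ E : ℝ) * ((finrank ℝ E : ℝ) - 1)) x :=
    hscalar.sub mdifferentiableAt_const
  have hV := mdiffAt_gradient hf.contMDiff x
  rw [dirDeriv_mul _ hexcess (mdiffAt_inner hV hV),
    dirDeriv_sub _ hscalar mdifferentiableAt_const, dirDeriv_const, sub_zero,
    hf.dirDeriv_gradient_scalarCurvature, dirDeriv_inner hV hV hV]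
  simp only [covDeriv, hf.leviCivita_gradient, inner_neg_left, inner_neg_right,
    real_inner_smul_left, real_inner_smul_right]
  ring

theorem scalarCurvature_eq [Nontrivial E] [BoundarylessManifold I M] [CompactSpace M]
    (hf : IsObataFunction I f) (henergy : ∀ x, energy I f x ≠ 0)
    (hscalar : ∀ x : M, (finrank ℝ E : ℝ) * ((finrank ℝ E : ℝ) - 1) ≤ scalarCurvature I x) (x : M) :
    scalarCurvature I x = (finrank ℝ E : ℝ) * ((finrank ℝ E : ℝ) - 1) := by
  have hV := contMDiff_gradient hf.contMDiff
  have hle := nonpos_of_dirDeriv_gradient_eq_zero hf.contMDiff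
    ((contMDiff_scalarCurvature.sub contMDiff_const).mul (contMDiff_inner hV hV))
    hf.dirDeriv_scalarCurvature_sub_mul_gradient_sq
    fun y hy ↦ by rw [Pi.mul_apply, hy, inner_zero_left, mul_zero]
  have hclosed : IsClosed
      {y : M | scalarCurvature I y = (finrank ℝ E : ℝ) * ((finrank ℝ E : ℝ) - 1)} :=
    isClosed_eq contMDiff_scalarCurvature.continuous continuous_const
  refine hclosed.closure_subset (mem_closure_iff_frequently.2
    ((hf.frequently_gradient_ne_zero (henergy x)).mono fun y hy ↦ ?_))
  have hpos : 0 < inner ℝ (gradient I f y) (gradient I f y) := real_inner_self_pos.2 hy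
  exact (sub_nonpos.1 (nonpos_of_mul_nonpos_left (hle y) hpos)).antisymm (hscalar y)

end IsObataFunction

theorem sum_ricci_sub_mul_inner {ι : Type*} [Fintype ι]
    (b : OrthonormalBasis ι ℝ (TangentSpace I x)) (c : ℝ) :
    ∑ i, (ricci x (b i) (b i) - c * inner ℝ (b i) (b i)) =
      scalarCurvature I x - (finrank ℝ E : ℝ) * c := by
  have hcard : finrank ℝ E = Fintype.card ι := finrank_eq_card_basis b.toBasis
  have hunit (i : ι) : inner ℝ (b i) (b i) = (1 : ℝ) :=
    inner_self_eq_one_of_norm_eq_one (b.norm_eq_one i)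
  simp only [hunit, mul_one, Finset.sum_sub_distrib, scalarCurvature_eq_sum b, hcard,
    Finset.sum_const, Finset.card_univ, nsmul_eq_mul]

theorem finrank_mul_le_scalarCurvature {c : ℝ}
    (hRic : ∀ v : TangentSpace I x, c * inner ℝ v v ≤ ricci x v v) :
    (finrank ℝ E : ℝ) * c ≤ scalarCurvature I x := by
  rw [← sub_nonneg, ← sum_ricci_sub_mul_inner (stdOrthonormalBasis ℝ (TangentSpace I x))]
  exact Finset.sum_nonneg fun i _ ↦ sub_nonneg.2 (hRic _)

theorem ricci_eq_of_scalarCurvature_eq {c : ℝ}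
    (hRic : ∀ v : TangentSpace I x, c * inner ℝ v v ≤ ricci x v v)
    (hscalar : scalarCurvature I x = (finrank ℝ E : ℝ) * c) (v w : TangentSpace I x) :
    ricci x v w = c * inner ℝ v w := by
  have b := stdOrthonormalBasis ℝ (TangentSpace I x)
  refine sub_eq_zero.1 (bilin_eq_zero_of_trace_eq_zero (ricciForm x - c • innerₗ _) b
    (fun u u' ↦ ?_) (fun u ↦ sub_nonneg.2 (hRic u)) ?_ v w)
  · change ricci x u u' - c * inner ℝ u u' = ricci x u' u - c * inner ℝ u' u
    rw [ricci_comm, real_inner_comm]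
  · exact (sum_ricci_sub_mul_inner b c).trans (sub_eq_zero.2 hscalar)

end Riemannian

end RiemannianGeometry

end

open RiemannianGeometry Module in
theorem proposition2_general {E : Type*} [NormedAddCommGroup E] [NormedSpace ℝ E]
    [FiniteDimensional ℝ E] {H : Type*} [TopologicalSpace H] {I : ModelWithCorners ℝ E H}
    [I.Boundaryless] {M : Type*} [TopologicalSpace M] [T2Space M] [CompactSpace M]
    [PreconnectedSpace M] [ChartedSpace H M] [IsManifold I ∞ M]
    [RiemannianBundle (fun x : M ↦ TangentSpace I x)]
    [IsContMDiffRiemannianBundle I ∞ E (fun x : M ↦ TangentSpace I x)]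
    (hRic : ∀ (x : M) (v : TangentSpace I x),
      ((finrank ℝ E : ℝ) - 1) * inner ℝ v v ≤ ricci x v v)
    {f : M → ℝ} (hf : ContMDiff I 𝓘(ℝ, ℝ) ∞ f) (hf0 : f ≠ 0)
    (hΔ : ∀ x : M, laplacian I f x = (finrank ℝ E : ℝ) * f x)
    (x : M) (v w : TangentSpace I x) :
    ricci x v w = ((finrank ℝ E : ℝ) - 1) * inner ℝ v w := by
  cases subsingleton_or_nontrivial E with
  | inl _ =>
    have : Subsingleton (TangentSpace I x) := inferInstanceAs (Subsingleton E)
    rw [Subsingleton.elim v 0, inner_zero_left, mul_zero]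
    exact (ricciForm x).map_zero₂ w
  | inr _ =>
    obtain ⟨y, hy⟩ := Function.ne_iff.1 hf0
    have henergy (z : M) : energy I f z ≠ 0 := by
      rw [energy_eq hRic hf hΔ z y]
      exact (add_pos_of_nonneg_of_pos real_inner_self_nonneg (mul_self_pos.2 hy)).ne'
    have hscalar := (isObataFunction hRic hf hΔ).scalarCurvature_eq henergy
      fun z ↦ finrank_mul_le_scalarCurvature (hRic z)
    exact ricci_eq_of_scalarCurvature_eq (hRic x) (hscalar x) v w

theorem proposition2 (n : ℕ)
    {M : Type*} [TopologicalSpace M] [T2Space M] [CompactSpace M] [ConnectedSpace M]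
    [ChartedSpace (EuclideanSpace ℝ (Fin n)) M] [IsManifold (𝓡 n) ∞ M]
    [RiemannianBundle (fun x : M ↦ TangentSpace (𝓡 n) x)]
    [IsContMDiffRiemannianBundle (𝓡 n) ∞ (EuclideanSpace ℝ (Fin n))
      (fun x : M ↦ TangentSpace (𝓡 n) x)]
    (hRic : ∀ (x : M) (v : TangentSpace (𝓡 n) x),
      ((n : ℝ) - 1) * inner ℝ v v ≤ RiemannianGeometry.ricci x v v)
    (f : M → ℝ) (hf : ContMDiff (𝓡 n) 𝓘(ℝ, ℝ) ∞ f) (hf0 : f ≠ 0)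
    (hΔ : ∀ x : M, RiemannianGeometry.laplacian (𝓡 n) f x = (n : ℝ) * f x) :
    RiemannianGeometry.IsEinstein (𝓡 n) M :=
  ⟨_, proposition2_general (by simpa only [finrank_euclideanSpace_fin]) hf hf0
    (by simpa only [finrank_euclideanSpace_fin])⟩
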